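/- Let $K=(K,\prec)$ be an abstract elementary class (AEC) with Löwenheim–Skolem number $\mathrm{LS}(K)$, such that $K$ has no models of cardinality $<\mathrm{LS}(K)$ and $K$ has the amalgamation property (no joint embedding and no absence of maximal models is assumed). Let $\kappa>\mathrm{LS}(K)$ be a cardinal. Suppose that $K$ is categorical in a cardinal $\lambda$ (i.e. $K$ has, up to isomorphism, exactly one model of cardinality $\lambda$) with $\lambda=\lambda^{<\kappa}=\sup_{\mu<\kappa}\lambda^{\mu}$, and put $$\chi=\min\Big\{\lambda,\ \sup_{\mu<\kappa}\beth_{(2^{\mu})^{+}}\Big\}.$$ Then: (1) every $M\in K$ with $\|M\|\ge\chi$ is $\kappa$-saturated, i.e. for every $N\prec M$ with $\|N\|<\kappa$, every Galois type $p\in S(N)$ (of a single element) is realized in $M$; (2) in particular, Existence for non-forking holds over all models of cardinality at least $\chi$: for all $M_0\prec\widehat M$ in $K$ with $\|M_0\|\ge\chi$ and every set $A\subseteq|\widehat M|$ (of any cardinality), $A$ is independent from $M_0$ over $M_0$ in $\widehat M$. Here, for $M_0\prec N\prec\widehat M$ in $K$ and $A\subseteq|\widehat M|$, "$A$ is independent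 from $N$ over $M_0$ in $\widehat M$" (the type of $A$ over $N$ does not fork over $M_0$) means that for every sequence $a$ of elements of $A$ of length $<\kappa$ and every $N^-\prec N$ with $\|N^-\|<\kappa$, the Galois type $\mathrm{tp}(a/N^-,\widehat M)$ is realized by a sequence from $M_0$. Galois types are taken without a monster model: $\mathrm{tp}(a/M,N)=\mathrm{tp}(b/M,N')$ iff there are $P\in K$ and $K$-embeddings $g:N\to P$, $h:N'\to P$ with $g\restriction M=h\restriction M$ and $g(a)=h(b)$. -/

import Mathlib

open FirstOrder FirstOrder.Language Cardinal

universe u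

/-- A class of `L`-structures together with a relation `S ≺ N` between `L`-structures `N` and
their `L`-substructures `S`; no laws are required yet. -/
structure AbstractClass (L : FirstOrder.Language.{u, u}) where
  /-- `M ∈ K` -/
  IsModel : ∀ (M : Type u) [L.Structure M], Prop
  /-- `S ≺ N`, for a substructure `S` of `N` -/
  Strong : ∀ {N : Type u} [L.Structure N], L.Substructure N → Prop

namespace AbstractClass

variable {L : FirstOrder.Language.{u, u}} (K : AbstractClass L)

/-- `S ≺ T` for two substructures `S`, `T` of the same `L`-structure: `S` is contained in `T` and,
seen as a substructure of the structure `T`, it is strong in `T`. -/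
def Sub {N : Type u} [L.Structure N] (S T : L.Substructure N) : Prop :=
  S ≤ T ∧ K.Strong (S.comap T.subtype.toHom)

/-- `⟨S i : i < α⟩` is a `≺`-increasing continuous chain of members of `K`. (The ambient structure
`N` need not belong to `K`: the union of an increasing chain of structures is an `L`-structure
in which all of them are substructures.) -/
structure IsChain {N : Type u} [L.Structure N] (α : Ordinal.{u})
    (S : Ordinal.{u} → L.Substructure N) : Prop where
  isModel : ∀ i < α, K.IsModel (S i)
  increasing : ∀ j < α, ∀ i ≤ j, K.Sub (S i) (S j)
  continuous : ∀ δ < α, Order.IsSuccLimit δ → S δ = ⨆ i < δ, S i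

/-- `μ` is an infinite cardinal, at least the number of symbols of `L`, with the
downward Löwenheim–Skolem property for `K`. -/
def IsLSBound (μ : Cardinal.{u}) : Prop :=
  ℵ₀ ≤ μ ∧ L.card ≤ μ ∧
    ∀ (M : Type u) [L.Structure M], K.IsModel M → ∀ A : Set M,
      ∃ S : L.Substructure M, K.Strong S ∧ A ⊆ S ∧ #S ≤ #A + μ

end AbstractClass

/-- Abstract elementary classes in the language `L`. Antisymmetry of `≺` is automatic, as it
refines inclusion. -/
structure AEC (L : FirstOrder.Language.{u, u}) extends AbstractClass L where
  isModel_of_strong : ∀ {N : Type u} [L.Structure N] {S : L.Substructure N},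
    toAbstractClass.Strong S → IsModel S ∧ IsModel N
  strong_refl : ∀ {N : Type u} [L.Structure N], IsModel N →
    toAbstractClass.Strong (⊤ : L.Substructure N)
  strong_trans : ∀ {N : Type u} [L.Structure N] {S T : L.Substructure N},
    toAbstractClass.Sub S T → toAbstractClass.Strong T → toAbstractClass.Strong S
  isModel_iso : ∀ {N N' : Type u} [L.Structure N] [L.Structure N'],
    (N ≃[L] N') → IsModel N → IsModel N'
  strong_iso : ∀ {N N' : Type u} [L.Structure N] [L.Structure N'] (f : N ≃[L] N')
    {S : L.Substructure N}, toAbstractClass.Strong S → toAbstractClass.Strong (S.map f.toHom)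
  coherence : ∀ {N : Type u} [L.Structure N] {S T : L.Substructure N},
    toAbstractClass.Strong S → toAbstractClass.Strong T → S ≤ T → toAbstractClass.Sub S T
  isModel_union : ∀ {N : Type u} [L.Structure N] {α : Ordinal.{u}}
    {S : Ordinal.{u} → L.Substructure N}, α ≠ 0 → toAbstractClass.IsChain α S →
      IsModel (⨆ i < α, S i : L.Substructure N) ∧
        ∀ i < α, toAbstractClass.Sub (S i) (⨆ i < α, S i)
  union_strong : ∀ {N : Type u} [L.Structure N] {α : Ordinal.{u}}
    {S : Ordinal.{u} → L.Substructure N}, α ≠ 0 → toAbstractClass.IsChain α S →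
      IsModel N → (∀ i < α, toAbstractClass.Strong (S i)) →
        toAbstractClass.Strong (⨆ i < α, S i)
  exists_isLSBound : ∃ μ : Cardinal.{u}, toAbstractClass.IsLSBound μ

namespace AEC

variable {L : FirstOrder.Language.{u, u}} (K : AEC L)

/-- The Löwenheim–Skolem number `LS(K)`. -/
noncomputable def LS : Cardinal.{u} := sInf {μ | K.IsLSBound μ}

/-- `f` is a `K`-embedding: an isomorphism onto a strong substructure. -/
def IsEmb {M N : Type u} [L.Structure M] [L.Structure N] (f : M ↪[L] N) : Prop :=
  K.Strong f.toHom.range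

theorem isEmb_subtype {N : Type u} [L.Structure N] {S : L.Substructure N} (hS : K.Strong S) :
    K.IsEmb S.subtype := by
  unfold IsEmb
  rwa [Substructure.range_subtype]

/-- The amalgamation property. -/
def Amalgamation : Prop :=
  ∀ (M N₀ N₁ : Type u) [L.Structure M] [L.Structure N₀] [L.Structure N₁]
    (f₀ : M ↪[L] N₀) (f₁ : M ↪[L] N₁), K.IsEmb f₀ → K.IsEmb f₁ →
    ∃ (P : Type u) (_ : L.Structure P) (g₀ : N₀ ↪[L] P) (g₁ : N₁ ↪[L] P),
      K.IsEmb g₀ ∧ K.IsEmb g₁ ∧ g₀.comp f₀ = g₁.comp f₁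

/-- `K` has, up to isomorphism, exactly one model of cardinality `lam`. -/
def Categorical (lam : Cardinal.{u}) : Prop :=
  (∃ (M : Type u) (_ : L.Structure M), K.IsModel M ∧ #M = lam) ∧
    ∀ (M N : Type u) [L.Structure M] [L.Structure N], K.IsModel M → K.IsModel N →
      #M = lam → #N = lam → Nonempty (M ≃[L] N)

/-- A sequence `a`, indexed by `I`, in some strong extension `N` of `M`. -/
structure PointedExt (M : Type u) [L.Structure M] (I : Type u) where
  N : Type u
  [str : L.Structure N]
  emb : M ↪[L] N
  isEmb : K.IsEmb emb
  a : I → N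

attribute [instance] PointedExt.str

/-- Two sequences in extensions of `M` are identified when the extensions can be amalgamated
over `M` so that the sequences become equal. -/
def AmalgEq {M : Type u} [L.Structure M] {I : Type u} (x y : K.PointedExt M I) : Prop :=
  ∃ (P : Type u) (_ : L.Structure P) (g : x.N ↪[L] P) (h : y.N ↪[L] P),
    K.IsEmb g ∧ K.IsEmb h ∧ g.comp x.emb = h.comp y.emb ∧ ∀ i, g (x.a i) = h (y.a i)

/-- `S^I(M)`: the Galois types over `M` of sequences indexed by `I`, i.e. the classes of the
equivalence relation generated by `AmalgEq` (which is itself an equivalence relation when `K`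
has amalgamation). -/
def GaloisType (M : Type u) [L.Structure M] (I : Type u) : Type (u + 1) :=
  Quot (K.AmalgEq (M := M) (I := I))

/-- The Galois type `tp(a / M, N)`, where `M` is embedded in `N` by `f`. -/
def tp {M N : Type u} [L.Structure M] [L.Structure N] (f : M ↪[L] N) (hf : K.IsEmb f)
    {I : Type u} (a : I → N) : K.GaloisType M I :=
  Quot.mk _ ⟨N, f, hf, a⟩

/-- The Galois type `tp(a / S, N)` over a strong substructure `S` of `N`. -/
def tpOver {N : Type u} [L.Structure N] (S : L.Substructure N) (hS : K.Strong S)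
    {I : Type u} (a : I → N) : K.GaloisType S I :=
  K.tp S.subtype (K.isEmb_subtype hS) a

/-- `M` is (Galois) `μ`-saturated: it realizes all types, of single elements, over its strong
substructures of cardinality `< μ`. -/
def Saturated (μ : Cardinal.{u}) (M : Type u) [L.Structure M] : Prop :=
  ∀ (S : L.Substructure M) (hS : K.Strong S), #S < μ →
    ∀ p : K.GaloisType S PUnit.{u + 1}, ∃ a : PUnit.{u + 1} → M, K.tpOver S hS a = p

/-- `A` is independent from `N` over `M₀`, computed in the ambient model `C`: here
`M₀ ≺ N ≺ C`, `A ⊆ C`, and for every sequence `a` of length `< κ` in `A` and every `N' ≺ N` of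
cardinality `< κ`, the type `tp(a / N', C)` is realized in `M₀`. -/
def NonForking (κ : Cardinal.{u}) {C : Type u} [L.Structure C] (A : Set C)
    (M₀ N : L.Substructure C) : Prop :=
  K.Sub M₀ N ∧ ∃ hN : K.Strong N,
    ∀ (I : Type u) (a : I → C), #I < κ → (∀ i, a i ∈ A) →
      ∀ (N' : L.Substructure C) (hN' : K.Sub N' N), #N' < κ →
        ∃ b : I → C, (∀ i, b i ∈ M₀) ∧
          K.tpOver N' (K.strong_trans hN' hN) b = K.tpOver N' (K.strong_trans hN' hN) a

/-- Existence for non-forking, for sets of cardinality `α` and models of cardinality `μ`: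
every such set `A` is independent from every such `M₀` over `M₀`, in every ambient model. -/
def Existence (κ α μ : Cardinal.{u}) : Prop :=
  ∀ (C : Type u) [L.Structure C] (M₀ : L.Substructure C) (A : Set C),
    K.Strong M₀ → #A = α → #M₀ = μ → K.NonForking κ A M₀ M₀

end AEC

/-- The threshold `min {lam, sup_{μ < κ} ℶ_{(2 ^ μ)⁺}}`. -/
noncomputable def satThreshold (lam κ : Cardinal.{u}) : Cardinal.{u} :=
  min lam (⨆ μ : Set.Iio κ, beth (Order.succ ((2 : Cardinal.{u}) ^ (μ : Cardinal.{u}))).ord)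

/-! The notion to work with is model-homogeneity: every extension of size `< κ` of a strong submodel
embeds in the model over it. With amalgamation this yields saturation, and also existence for
non-forking, so it suffices to show that all models of size at least χ are `κ`-model-homogeneous
(`modelHomogeneous_of_categorical`).

In size λ this comes from λ = λ^{<κ}: there are at most λ small extension problems, so they can all
be solved inside an extension of size λ (`exists_modelHomogeneous_extension`), and categoricity
makes every model of size λ isomorphic to it. Larger models inherit the property, since a small
submodel lies in a strong submodel of size λ.

Below λ the ℶ-bound is used. Given such an `M` and a small `N ≺ M`, Morley's method
(`exists_template`, an iterated Erdős–Rado argument) finds arbitrarily large finite subsets of `M`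
whose hulls over `N` depend, up to isomorphism, only on the number of points. Gluing these hulls
along a linear order of size λ gives a model `C` of size λ in which every element lies in a copy,
over `N`, of a strong submodel of `M` (`exists_ehrenfeuchtMostowski`). As `C` is saturated, types
over `N` are realized in `C`, hence in `M` (`elementSaturated_of_beth_le`). This transfer catches
single elements only; a back-and-forth with a homogeneous extension of `M` upgrades it to
model-homogeneity (`ElementSaturated.modelHomogeneous`). -/

namespace AEC
variable {L : FirstOrder.Language.{u, u}} (K : AEC L)

/-! ### Calculus of `K`-embeddings -/

section Embeddings

variable {M N P Q : Type u} [L.Structure M] [L.Structure N] [L.Structure P] [L.Structure Q]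

theorem IsEmb.isModel_left {K : AEC L} {f : M ↪[L] N} (hf : K.IsEmb f) : K.IsModel M :=
  K.isModel_iso f.equivRange.symm (K.isModel_of_strong hf).1

theorem IsEmb.isModel_right {K : AEC L} {f : M ↪[L] N} (hf : K.IsEmb f) : K.IsModel N :=
  (K.isModel_of_strong hf).2

theorem isEmb_equiv (hM : K.IsModel M) (e : M ≃[L] N) : K.IsEmb e.toEmbedding := by
  have h : e.toEmbedding.toHom.range = ⊤ := by
    ext x
    exact ⟨fun _ => trivial, fun _ => ⟨e.symm x, e.apply_symm_apply x⟩⟩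
  unfold IsEmb
  rw [h]
  exact K.strong_refl (K.isModel_iso e hM)

theorem IsEmb.equiv_comp {K : AEC L} {f : M ↪[L] N} (hf : K.IsEmb f) (e : N ≃[L] P) :
    K.IsEmb (e.toEmbedding.comp f) := by
  have h : (e.toEmbedding.comp f).toHom.range = f.toHom.range.map e.toHom := by
    ext x
    constructor
    · rintro ⟨y, rfl⟩
      exact ⟨f y, ⟨y, rfl⟩, rfl⟩
    · rintro ⟨_, ⟨y, rfl⟩, rfl⟩
      exact ⟨y, rfl⟩
  unfold IsEmb
  rw [h]
  exact K.strong_iso e hf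

theorem IsEmb.comp_equiv {K : AEC L} {f : N ↪[L] P} (hf : K.IsEmb f) (e : M ≃[L] N) :
    K.IsEmb (f.comp e.toEmbedding) := by
  have h : (f.comp e.toEmbedding).toHom.range = f.toHom.range := by
    ext x
    constructor
    · rintro ⟨y, rfl⟩
      exact ⟨e y, rfl⟩
    · rintro ⟨y, rfl⟩
      exact ⟨e.symm y, congrArg f (e.apply_symm_apply y)⟩
  unfold IsEmb
  rw [h]
  exact hf

/-- `Sub` for ranges: `f` is a `K`-embedding iff its range is strong inside the range of `g`. -/
theorem sub_range_iff (f : M ↪[L] N) (g : N ↪[L] P) :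
    K.Sub (g.comp f).toHom.range g.toHom.range ↔ K.IsEmb f := by
  have h1 : f.toHom.range.map g.equivRange.toHom =
      (g.comp f).toHom.range.comap g.toHom.range.subtype.toHom := by
    ext ⟨x, hx⟩
    constructor
    · rintro ⟨_, ⟨y, rfl⟩, hy⟩
      exact ⟨y, congrArg Subtype.val hy⟩
    · rintro ⟨y, hy⟩
      exact ⟨f y, ⟨y, rfl⟩, Subtype.ext hy⟩
  have h2 : ((g.comp f).toHom.range.comap g.toHom.range.subtype.toHom).map
      g.equivRange.symm.toHom = f.toHom.range := by
    rw [← h1]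
    ext x
    constructor
    · rintro ⟨_, ⟨y, hy, rfl⟩, hx⟩
      have : y = x := (g.equivRange.symm_apply_apply y).symm.trans hx
      exact this ▸ hy
    · intro hx
      exact ⟨_, ⟨x, hx, rfl⟩, g.equivRange.symm_apply_apply x⟩
  constructor
  · intro h
    have := K.strong_iso g.equivRange.symm h.2
    rw [h2] at this
    exact this
  · intro h
    refine ⟨?_, ?_⟩
    · rintro _ ⟨y, rfl⟩
      exact ⟨f y, rfl⟩
    · have := K.strong_iso g.equivRange h
      rw [h1] at this
      exact this

theorem IsEmb.comp {K : AEC L} {f : M ↪[L] N} {g : N ↪[L] P} (hg : K.IsEmb g) (hf : K.IsEmb f) :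
    K.IsEmb (g.comp f) :=
  K.strong_trans ((K.sub_range_iff f g).2 hf) hg

/-- This is the coherence axiom read on ranges: both are strong in `P`, one inside the other. -/
theorem IsEmb.of_comp {K : AEC L} {f : M ↪[L] N} {g : N ↪[L] P} (hg : K.IsEmb g)
    (h : K.IsEmb (g.comp f)) : K.IsEmb f := by
  refine (K.sub_range_iff f g).1 (K.coherence h hg ?_)
  rintro _ ⟨y, rfl⟩
  exact ⟨f y, rfl⟩

theorem isEmb_refl (hM : K.IsModel M) : K.IsEmb (Embedding.refl L M) :=
  K.isEmb_equiv hM (FirstOrder.Language.Equiv.refl L M)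

theorem sub_iff {S T : L.Substructure N} :
    K.Sub S T ↔ ∃ h : S ≤ T, K.IsEmb (Substructure.inclusion h) := by
  constructor
  · intro h
    refine ⟨h.1, (K.sub_range_iff _ T.subtype).1 ?_⟩
    rwa [Substructure.subtype_comp_inclusion, Substructure.range_subtype,
      Substructure.range_subtype]
  · rintro ⟨h, he⟩
    have := (K.sub_range_iff _ T.subtype).2 he
    rwa [Substructure.subtype_comp_inclusion, Substructure.range_subtype,
      Substructure.range_subtype] at this

theorem _root_.AbstractClass.Sub.trans {K : AEC L} {S T R : L.Substructure N} (h : K.Sub S T) (h' : K.Sub T R) :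
    K.Sub S R := by
  obtain ⟨h1, h2⟩ := K.sub_iff.1 h
  obtain ⟨h3, h4⟩ := K.sub_iff.1 h'
  exact K.sub_iff.2 ⟨h1.trans h3, h4.comp h2⟩

theorem _root_.AbstractClass.Sub.isModel_left {K : AEC L} {S T : L.Substructure N}
    (h : K.Sub S T) : K.IsModel S := by
  obtain ⟨h1, h2⟩ := K.sub_iff.1 h
  exact h2.isModel_left

theorem strong_iff_isEmb {S : L.Substructure N} : K.Strong S ↔ K.IsEmb S.subtype := by
  unfold IsEmb
  rw [Substructure.range_subtype]

theorem strong_iff_sub_top {S : L.Substructure N} : K.Strong S ↔ K.Sub S ⊤ := by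
  have h : S.subtype = (Substructure.topEquiv (M := N)).toEmbedding.comp
      (Substructure.inclusion (le_top : S ≤ ⊤)) := rfl
  rw [K.strong_iff_isEmb, h, K.sub_iff]
  constructor
  · intro hS
    refine ⟨le_top, IsEmb.of_comp (K.isEmb_equiv ?_ _) hS⟩
    exact K.isModel_iso Substructure.topEquiv.symm hS.isModel_right
  · rintro ⟨_, hS⟩
    exact hS.equiv_comp _

/-- `Sub` is computed inside any larger substructure. -/
theorem sub_comap_iff {S T R : L.Substructure N} (hST : S ≤ T) (hTR : T ≤ R) :
    K.Sub (S.comap R.subtype.toHom) (T.comap R.subtype.toHom) ↔ K.Sub S T := by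
  have hS : S.comap R.subtype.toHom = ((Substructure.inclusion hTR).comp
      (Substructure.inclusion hST)).toHom.range := by
    ext x
    exact ⟨fun hx => ⟨⟨x, hx⟩, rfl⟩, by rintro ⟨y, rfl⟩; exact y.2⟩
  have hT : T.comap R.subtype.toHom = (Substructure.inclusion hTR).toHom.range := by
    ext x
    exact ⟨fun hx => ⟨⟨x, hx⟩, rfl⟩, by rintro ⟨y, rfl⟩; exact y.2⟩
  rw [hS, hT, K.sub_range_iff, K.sub_iff]
  exact ⟨fun h => ⟨hST, h⟩, fun h => h.2⟩

end Embeddings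

/-! ### Hulls of prescribed size -/

section LowenheimSkolem

theorem isLSBound_LS : K.IsLSBound K.LS :=
  csInf_mem (s := {μ | K.IsLSBound μ}) K.exists_isLSBound

theorem aleph0_le_LS : ℵ₀ ≤ K.LS := K.isLSBound_LS.1

theorem card_le_LS : L.card ≤ K.LS := K.isLSBound_LS.2.1

theorem exists_hull {M : Type u} [L.Structure M] (hM : K.IsModel M) (A : Set M) :
    ∃ S : L.Substructure M, K.Strong S ∧ A ⊆ S ∧ #S ≤ #A + K.LS :=
  K.isLSBound_LS.2.2 M hM A

theorem exists_hull_le {M : Type u} [L.Structure M] (hM : K.IsModel M) (A : Set M)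
    {μ : Cardinal.{u}} (hμ : K.LS ≤ μ) (hA : #A ≤ μ) :
    ∃ S : L.Substructure M, K.Strong S ∧ A ⊆ S ∧ #S ≤ μ := by
  obtain ⟨S, h1, h2, h3⟩ := K.exists_hull hM A
  exact ⟨S, h1, h2, h3.trans (Cardinal.add_le_of_le (K.aleph0_le_LS.trans hμ) hA hμ)⟩

theorem exists_hull_lt {M : Type u} [L.Structure M] (hM : K.IsModel M) (A : Set M)
    {κ : Cardinal.{u}} (hκ : K.LS < κ) (hA : #A < κ) :
    ∃ S : L.Substructure M, K.Strong S ∧ A ⊆ S ∧ #S < κ := by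
  obtain ⟨S, h1, h2, h3⟩ := K.exists_hull hM A
  exact ⟨S, h1, h2, h3.trans_lt (Cardinal.add_lt_of_lt (K.aleph0_le_LS.trans hκ.le) hA hκ)⟩

theorem exists_hull_eq {M : Type u} [L.Structure M] (hM : K.IsModel M) (A : Set M)
    {μ : Cardinal.{u}} (hμ : K.LS ≤ μ) (hA : #A ≤ μ) (hμM : μ ≤ #M) :
    ∃ S : L.Substructure M, K.Strong S ∧ A ⊆ S ∧ #S = μ := by
  obtain ⟨B, hB⟩ := Cardinal.le_mk_iff_exists_set.1 hμM
  obtain ⟨S, h1, h2, h3⟩ := K.exists_hull_le hM (A ∪ B) hμ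
    ((Cardinal.mk_union_le A B).trans
      (Cardinal.add_le_of_le (K.aleph0_le_LS.trans hμ) hA hB.le))
  refine ⟨S, h1, Set.subset_union_left.trans h2, h3.antisymm ?_⟩
  rw [← hB]
  exact Cardinal.mk_le_mk_of_subset (Set.subset_union_right.trans h2)

end LowenheimSkolem

end AEC

/-! ### Directed unions and direct limits -/

/-- In a directed preorder, finite sets of indices have upper bounds depending monotonically on
the set. -/
theorem exists_monotone_finset_bound {A : Type*} {D : Type*} [Preorder D] [Nonempty D]
    [IsDirectedOrder D] (h : A → D) :
    ∃ g : Finset A → D, Monotone g ∧ ∀ s, ∀ a ∈ s, h a ≤ g s := by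
  classical
  have hub : ∀ F : Finset D, ∃ d, ∀ x ∈ F, x ≤ d := fun F => F.exists_le
  choose ub hub using hub
  -- The value at `s` bounds all values at proper subsets as well; this forces monotonicity.
  let H : ∀ s : Finset A, (∀ t, t ⊂ s → D) → D := fun s ih =>
    ub (s.image h ∪ s.ssubsets.attach.image
      (fun t => ih t.1 (Finset.mem_ssubsets.1 t.2)))
  let g : Finset A → D := fun s => Finset.strongInduction H s
  have hg : ∀ s, g s = H s (fun t _ => g t) := fun s => Finset.strongInduction_eq H s
  refine ⟨g, ?_, ?_⟩
  · intro t s hts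
    rcases hts.eq_or_ssubset with rfl | hlt
    · exact le_rfl
    · rw [hg s]
      apply hub
      refine Finset.mem_union_right _ (Finset.mem_image.2 ⟨⟨t, Finset.mem_ssubsets.2 hlt⟩, ?_, rfl⟩)
      exact Finset.mem_attach _ _
  · intro s a ha
    rw [hg s]
    apply hub
    exact Finset.mem_union_left _ (Finset.mem_image_of_mem h ha)

/-- An enumeration of `I` by ordinals below the cardinality of `I`. -/
theorem exists_rank_lt_ord (I : Type u) :
    ∃ ρ : I → Ordinal.{u}, (∀ i, ρ i < (#I).ord) ∧
      ∀ α < (#I).ord, #{i // ρ i < α} < #I := by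
  obtain ⟨e⟩ : Nonempty (I ≃ (#I).ord.ToType) := Cardinal.eq.1 (by simp)
  refine ⟨fun i => ((Ordinal.ToType.mk.symm (e i) : Set.Iio (#I).ord) : Ordinal), fun i =>
    (Ordinal.ToType.mk.symm (e i)).2, fun α hα => ?_⟩
  refine lt_of_lt_of_eq (lt_of_le_of_lt ?_
    (Cardinal.mk_Iio_lt (Ordinal.ToType.mk ⟨α, hα⟩ : (#I).ord.ToType) (by simp))) (by simp)
  refine Cardinal.mk_le_of_injective (f := fun i => ⟨e i.1, ?_⟩) ?_
  · have := i.2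
    rw [Set.mem_Iio, ← OrderIso.symm_apply_lt]
    exact this
  · intro i j hij
    exact Subtype.ext (e.injective (congrArg Subtype.val hij))

namespace AEC
variable {L : FirstOrder.Language.{u, u}} (K : AEC L)

/-- Unions of chains of strong substructures of a substructure `T`. -/
theorem union_sub {N : Type u} [L.Structure N] {α : Ordinal.{u}}
    {S : Ordinal.{u} → L.Substructure N} (hα : α ≠ 0) (hS : K.IsChain α S)
    {T : L.Substructure N} (hT : K.IsModel T) (hST : ∀ i < α, K.Sub (S i) T) :
    K.Sub (⨆ i < α, S i) T := by
  have hle : (⨆ i < α, S i) ≤ T := iSup₂_le fun i hi => (hST i hi).1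
  -- The axiom `union_strong` concerns strength in the whole ambient structure, so the chain is
  -- pulled back to `T`, which becomes the ambient structure.
  let S' : Ordinal.{u} → L.Substructure T := fun i => (S i).comap T.subtype.toHom
  have hmem : ∀ i < α, ∀ x ∈ S i, x ∈ T := fun i hi x hx => (hST i hi).1 hx
  have hsup : ∀ β, β ≤ α → (⨆ i < β, S i).comap T.subtype.toHom = ⨆ i < β, S' i := by
    intro β hβ
    have h1 : (⨆ i < β, S i) = (⨆ i < β, S' i).map T.subtype.toHom := by
      simp only [Substructure.map_iSup]
      congr 1; ext1 i; congr 1; ext1 hi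
      apply le_antisymm
      · intro x hx
        exact ⟨⟨x, hmem i (hi.trans_le hβ) x hx⟩, hx, rfl⟩
      · exact Substructure.map_comap_le
    rw [h1]
    exact Substructure.comap_map_eq_of_injective T.subtype.injective _
  have hc : K.IsChain α S' := by
    refine ⟨fun i hi => ?_, fun j hj i hij => ?_, fun δ hδ hlim => ?_⟩
    · exact (K.isModel_of_strong (hST i hi).2).1
    · exact (K.sub_comap_iff (hS.increasing j hj i hij).1 (hST j hj).1).2
        (hS.increasing j hj i hij)
    · rw [← hsup δ hδ.le, ← hS.continuous δ hδ hlim]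
  have h := K.union_strong hα hc hT (fun i hi => (hST i hi).2)
  rw [← hsup α le_rfl] at h
  exact ⟨hle, h⟩

/-- Unions of systems of strong substructures indexed by the finite subsets of a set. -/
theorem iSup_finset (c : Cardinal.{u}) : ∀ (I : Type u), #I = c →
    ∀ {N : Type u} [L.Structure N] (S : Finset I → L.Substructure N),
    (∀ s t, s ⊆ t → K.Sub (S s) (S t)) →
    K.IsModel (⨆ s, S s : L.Substructure N) ∧ (∀ s, K.Sub (S s) (⨆ s, S s)) ∧
      ∀ T : L.Substructure N, K.IsModel T → (∀ s, K.Sub (S s) T) → K.Sub (⨆ s, S s) T := by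
  induction c using WellFoundedLT.induction with
  | ind c ih =>
  intro I hI N _ S hS
  classical
  have hmono : Monotone S := fun s t h => (hS s t h).1
  rcases finite_or_infinite I with hfin | hinf
  · have := Fintype.ofFinite I
    have h : (⨆ s, S s) = S Finset.univ :=
      le_antisymm (iSup_le fun s => hmono (Finset.subset_univ s)) (le_iSup S _)
    rw [h]
    exact ⟨(hS _ _ (Finset.Subset.refl Finset.univ)).isModel_left,
      fun s => hS s _ (Finset.subset_univ s),
      fun T _ hT => hT _⟩
  -- Initial segments of an enumeration of `I` of length `(#I).ord` have fewer elements than `I`, so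
  -- the induction hypothesis applies to the unions `T α` over their finite subsets. Its last clause
  -- makes these unions a chain; continuity holds because a finite set below a limit is bounded
  -- below it.
  obtain ⟨ρ, hρ, hsmall⟩ := exists_rank_lt_ord I
  have hcard : ℵ₀ ≤ #I := Cardinal.infinite_iff.1 hinf
  have hlimc : Order.IsSuccLimit (#I).ord := Cardinal.isSuccLimit_ord hcard
  let Sα : ∀ α : Ordinal.{u}, Finset {i // ρ i < α} → L.Substructure N := fun α s =>
    S (s.map (Function.Embedding.subtype _))
  let T : Ordinal.{u} → L.Substructure N := fun α => ⨆ s, Sα α s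
  have hSα : ∀ α, ∀ s t, s ⊆ t → K.Sub (Sα α s) (Sα α t) := fun α s t h =>
    hS _ _ (Finset.map_subset_map.2 h)
  have hle : ∀ α (s : Finset I), (∀ i ∈ s, ρ i < α) → ∃ s', Sα α s' = S s := by
    intro α s hs
    refine ⟨s.subtype _, ?_⟩
    simp only [Sα]
    rw [Finset.subtype_map_of_mem hs]
  have hmemT : ∀ α x, x ∈ T α ↔ ∃ s : Finset I, (∀ i ∈ s, ρ i < α) ∧ x ∈ S s := by
    intro α x
    have hd : Directed (· ≤ ·) (Sα α) := by
      intro s t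
      exact ⟨s ∪ t, (hSα α _ _ Finset.subset_union_left).1,
        (hSα α _ _ Finset.subset_union_right).1⟩
    simp only [T]
    rw [Substructure.mem_iSup_of_directed hd]
    constructor
    · rintro ⟨s, hs⟩
      refine ⟨_, ?_, hs⟩
      intro i hi
      obtain ⟨j, _, rfl⟩ := Finset.mem_map.1 hi
      exact j.2
    · rintro ⟨s, hs, hx⟩
      obtain ⟨s', hs'⟩ := hle α s hs
      exact ⟨s', hs' ▸ hx⟩
  have hbound : ∀ δ : Ordinal.{u}, Order.IsSuccLimit δ → ∀ s : Finset I, (∀ i ∈ s, ρ i < δ) →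
      ∃ α < δ, ∀ i ∈ s, ρ i < α := by
    intro δ hδ s hs
    refine ⟨s.sup (fun i => Order.succ (ρ i)), ?_, ?_⟩
    · rw [Finset.sup_lt_iff hδ.bot_lt]
      exact fun i hi => hδ.succ_lt (hs i hi)
    · intro i hi
      exact lt_of_lt_of_le (Order.lt_succ _) (Finset.le_sup (f := fun i => Order.succ (ρ i)) hi)
  have hIH : ∀ α < (#I).ord, K.IsModel (T α) ∧ (∀ s, K.Sub (Sα α s) (T α)) ∧
      ∀ R : L.Substructure N, K.IsModel R → (∀ s, K.Sub (Sα α s) R) → K.Sub (T α) R :=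
    fun α hα => ih _ (hI ▸ hsmall α hα) _ rfl (Sα α) (hSα α)
  have hsubT : ∀ α < (#I).ord, ∀ s : Finset I, (∀ i ∈ s, ρ i < α) → K.Sub (S s) (T α) := by
    intro α hα s hs
    obtain ⟨s', hs'⟩ := hle α s hs
    exact hs' ▸ (hIH α hα).2.1 s'
  have hchain : K.IsChain (#I).ord T := by
    refine ⟨fun α hα => (hIH α hα).1, fun β hβ α hαβ => ?_, fun δ hδ hlim => ?_⟩
    · refine (hIH α (hαβ.trans_lt hβ)).2.2 _ (hIH β hβ).1 fun s => hsubT β hβ _ ?_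
      intro i hi
      obtain ⟨j, _, rfl⟩ := Finset.mem_map.1 hi
      exact j.2.trans_le hαβ
    · apply le_antisymm
      · intro x hx
        obtain ⟨s, hs, hxs⟩ := (hmemT δ x).1 hx
        obtain ⟨α, hα, hsα⟩ := hbound δ hlim s hs
        exact (le_iSup₂ (f := fun i (_ : i < δ) => T i) α hα) ((hmemT α x).2 ⟨s, hsα, hxs⟩)
      · refine iSup₂_le fun α hα x hx => ?_
        obtain ⟨s, hs, hxs⟩ := (hmemT α x).1 hx
        exact (hmemT δ x).2 ⟨s, fun i hi => (hs i hi).trans hα, hxs⟩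
  have hne : (#I).ord ≠ 0 := hlimc.ne_bot
  have htop : (⨆ α < (#I).ord, T α) = ⨆ s, S s := by
    apply le_antisymm
    · refine iSup₂_le fun α hα => iSup_le fun s => le_iSup S _
    · refine iSup_le fun s => ?_
      obtain ⟨α, hα, hsα⟩ := hbound _ hlimc s (fun i _ => hρ i)
      exact (hsubT α hα s hsα).1.trans (le_iSup₂ (f := fun i (_ : i < (#I).ord) => T i) α hα)
  have hun := K.isModel_union hne hchain
  rw [htop] at hun
  refine ⟨hun.1, fun s => ?_, fun R hR hSR => ?_⟩
  · obtain ⟨α, hα, hsα⟩ := hbound _ hlimc s (fun i _ => hρ i)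
    exact (hsubT α hα s hsα).trans (hun.2 α hα)
  · have := K.union_sub hne hchain hR (fun α hα => (hIH α hα).2.2 R hR fun s => hSR _)
    rwa [htop] at this

/-- Unions of directed systems of strong substructures. -/
theorem iSup_directed {D : Type u} [Preorder D] [Nonempty D] [IsDirectedOrder D]
    {N : Type u} [L.Structure N] (S : D → L.Substructure N)
    (hS : ∀ d e, d ≤ e → K.Sub (S d) (S e)) :
    K.IsModel (⨆ d, S d : L.Substructure N) ∧ (∀ d, K.Sub (S d) (⨆ d, S d)) ∧
      ∀ T : L.Substructure N, K.IsModel T → (∀ d, K.Sub (S d) T) → K.Sub (⨆ d, S d) T := by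
  obtain ⟨g, hg, hge⟩ := exists_monotone_finset_bound (id : D → D)
  have h : (⨆ s, S (g s)) = ⨆ d, S d := by
    apply le_antisymm
    · exact iSup_le fun s => le_iSup S _
    · exact iSup_le fun d => (hS _ _ (hge {d} d (Finset.mem_singleton_self d))).1.trans
        (le_iSup (fun s => S (g s)) {d})
  obtain ⟨h1, h2, h3⟩ := K.iSup_finset #D D rfl (fun s => S (g s)) (fun s t hst => hS _ _ (hg hst))
  rw [h] at h1 h2 h3
  exact ⟨h1, fun d => (hS _ _ (hge {d} d (Finset.mem_singleton_self d))).trans (h2 {d}),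
    fun T hT hST => h3 T hT fun s => hST _⟩

theorem iSup_strong {D : Type u} [Preorder D] [Nonempty D] [IsDirectedOrder D]
    {N : Type u} [L.Structure N] (S : D → L.Substructure N) (hmono : Monotone S)
    (hS : ∀ d, K.Strong (S d)) : K.Strong (⨆ d, S d) := by
  rw [K.strong_iff_sub_top]
  refine (K.iSup_directed S fun d e hde => K.coherence (hS d) (hS e) (hmono hde)).2.2 _ ?_ ?_
  · obtain ⟨d⟩ := ‹Nonempty D›
    exact K.isModel_iso Substructure.topEquiv.symm (K.isModel_of_strong (hS d)).2
  · exact fun d => K.strong_iff_sub_top.1 (hS d)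

section DirectLimit

variable {ι : Type u} [Preorder ι] [Nonempty ι] [IsDirectedOrder ι]
  {G : ι → Type u} [∀ i, L.Structure (G i)] (f : ∀ i j, i ≤ j → G i ↪[L] G j)
  [DirectedSystem G fun i j h => f i j h]

/-- The ranges of the canonical maps form a directed system of substructures whose union is the
whole limit. -/
theorem directLimit (hf : ∀ i j h, K.IsEmb (f i j h)) :
    K.IsModel (Language.DirectLimit G f) ∧ ∀ i, K.IsEmb (DirectLimit.of L ι G f i) := by
  have hsub : ∀ i j, i ≤ j → K.Sub (DirectLimit.of L ι G f i).toHom.range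
      (DirectLimit.of L ι G f j).toHom.range := by
    intro i j hij
    have : DirectLimit.of L ι G f i = (DirectLimit.of L ι G f j).comp (f i j hij) := by
      ext x
      exact (DirectLimit.of_f (f := f)).symm
    rw [this]
    exact (K.sub_range_iff _ _).2 (hf i j hij)
  obtain ⟨h1, h2, -⟩ := K.iSup_directed _ hsub
  rw [DirectLimit.iSup_range_of_eq_top] at h1 h2
  exact ⟨K.isModel_iso Substructure.topEquiv h1, fun i => K.strong_iff_sub_top.2 (h2 i)⟩

end DirectLimit

end AEC

/-! ### End-homogeneous sets (Erdős–Rado) -/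

section EndHomogeneous

theorem mk_finset_le_of_le {α : Type u} {σ : Cardinal.{u}} (hσ : ℵ₀ ≤ σ) (h : #α ≤ σ) :
    #(Finset α) ≤ σ := by
  rcases finite_or_infinite α with hf | hi
  · exact (Cardinal.lt_aleph0_of_finite _).le.trans hσ
  · rwa [Cardinal.mk_finset_of_infinite]

/-- The type of bounded systems of colours over the initial segments of a successor cardinal. -/
theorem mk_sigma_initial_le {C : Type u} {σ : Cardinal.{u}} (hσ : ℵ₀ ≤ σ)
    (hC : #C ≤ 2 ^ σ) :
    #(Σ w : (Order.succ σ).ord.ToType, (Finset (Set.Iio w) → C)) ≤ 2 ^ σ := by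
  have h2 : ℵ₀ ≤ (2 : Cardinal.{u}) ^ σ := hσ.trans (Cardinal.cantor σ).le
  have h1 : ∀ w : (Order.succ σ).ord.ToType, #(Finset (Set.Iio w) → C) ≤ 2 ^ σ := by
    intro w
    have hw : #(Set.Iio w) ≤ σ := by
      have := Cardinal.mk_Iio_lt w (by simp)
      rw [Cardinal.mk_ord_toType] at this
      exact Order.lt_succ_iff.1 this
    rw [← Cardinal.power_def]
    calc #C ^ #(Finset (Set.Iio w)) ≤ (2 ^ σ) ^ #(Finset (Set.Iio w)) :=
          Cardinal.power_le_power_right hC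
      _ = 2 ^ (σ * #(Finset (Set.Iio w))) := (Cardinal.power_mul).symm
      _ ≤ 2 ^ σ := by
          refine Cardinal.power_le_power_left two_ne_zero ?_
          exact Cardinal.mul_le_of_le hσ le_rfl (mk_finset_le_of_le hσ hw)
  rw [Cardinal.mk_sigma]
  refine (Cardinal.sum_le_sum _ _ h1).trans ?_
  rw [Cardinal.sum_const', Cardinal.mk_ord_toType]
  exact Cardinal.mul_le_of_le h2 (Order.succ_le_of_lt (Cardinal.cantor σ)) le_rfl

/-- A colouring of the finite subsets of a set of size `> 2 ^ σ` is end-homogeneous on a subset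
of size `> σ`. -/
theorem exists_endHomogeneous {X C : Type u} [LinearOrder X] [WellFoundedLT X]
    (f : Finset X → C) (Y : Set X) {σ : Cardinal.{u}} (hσ : ℵ₀ ≤ σ) (hC : #C ≤ 2 ^ σ)
    (hY : 2 ^ σ < #Y) :
    ∃ Z ⊆ Y, σ < #Z ∧ ∃ g : Finset X → C, ∀ t : Finset X, ↑t ⊆ Z → ∀ z ∈ Z,
      (∀ x ∈ t, x < z) → f (insert z t) = g t := by
  classical
  let W := (Order.succ σ).ord.ToType
  -- The Erdős–Rado tree: `seq x` follows the branch towards `x`, taking at each level the least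
  -- point of `Y` above the earlier terms with the same colours over them as `x`. For `x` in `Y`,
  -- the fallback value `x` occurs only once the branch has reached `x`.
  let B : X → ∀ w : W, (∀ v : W, v < w → X) → Set X := fun x w ih =>
    {y | y ∈ Y ∧ (∀ v (h : v < w), ih v h < y) ∧ ∀ t : Finset (Set.Iio w),
      f (insert y (t.image fun v => ih v.1 v.2)) = f (insert x (t.image fun v => ih v.1 v.2))}
  let H : X → ∀ w : W, (∀ v : W, v < w → X) → X := fun x w ih =>
    if h : (B x w ih).Nonempty then WellFounded.min wellFounded_lt _ h else x
  let seq : X → W → X := fun x => WellFounded.fix wellFounded_lt (H x)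
  let A : X → W → Set X := fun x w => B x w fun v _ => seq x v
  have seq_eq : ∀ x w, seq x w = H x w fun v _ => seq x v := fun x w =>
    WellFounded.fix_eq wellFounded_lt (H x) w
  have hleast : ∀ x w, x ∈ A x w → IsLeast (A x w) (seq x w) := by
    intro x w hx
    have hne : (A x w).Nonempty := ⟨x, hx⟩
    have : seq x w = WellFounded.min wellFounded_lt (A x w) hne := by
      rw [seq_eq]
      exact dif_pos hne
    rw [this]
    exact ⟨WellFounded.min_mem _ _ _, fun y hy => not_lt.1 (WellFounded.not_lt_min _ _ hy)⟩
  have hself : ∀ x ∈ Y, ∀ w, (∀ v < w, seq x v ≠ x) → x ∈ A x w := by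
    intro x hx w
    induction w using WellFoundedLT.induction with
    | ind w ih =>
    intro hw
    refine ⟨hx, fun v hv => ?_, fun t => rfl⟩
    exact lt_of_le_of_ne ((hleast x v (ih v hv fun u hu => hw u (hu.trans hv))).2
      (ih v hv fun u hu => hw u (hu.trans hv))) (hw v hv)
  -- A branch that never reaches its target `x` has length σ⁺, and over earlier terms each of its
  -- points has the same colours as `x`.
  by_cases hlong : ∃ x ∈ Y, ∀ w, seq x w ≠ x
  · obtain ⟨x, hxY, hx⟩ := hlong
    have hmem : ∀ w, seq x w ∈ A x w := fun w =>
      (hleast x w (hself x hxY w fun v _ => hx v)).1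
    have hmono : StrictMono (seq x) := fun v w hvw => (hmem w).2.1 v hvw
    refine ⟨Set.range (seq x), ?_, ?_, fun t => f (insert x t), ?_⟩
    · rintro _ ⟨w, rfl⟩
      exact (hmem w).1
    · rw [Cardinal.mk_range_eq _ hmono.injective, Cardinal.mk_ord_toType]
      exact Order.lt_succ σ
    · rintro t ht _ ⟨w, rfl⟩ htw
      have : (t : Set X) ⊆ (fun v : Set.Iio w => seq x v.1) '' Set.univ := by
        intro u hu
        obtain ⟨v, rfl⟩ := ht hu
        exact ⟨⟨v, hmono.lt_iff_lt.1 (htw _ hu)⟩, trivial, rfl⟩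
      obtain ⟨t', -, rfl⟩ := Finset.subset_set_image_iff.1 this
      exact (hmem w).2.2 t'
  · exfalso
    push Not at hlong
    -- Otherwise `x` is determined by its level and its colours over the branch below it; there are
    -- at most 2^σ such data.
    have hcode : ∀ x : Y, ∃ p : Σ w : W, (Finset (Set.Iio w) → C), seq x p.1 = x ∧
        (∀ v < p.1, seq x v ≠ x) ∧
        ∀ t, p.2 t = f (insert x.1 (t.image fun v => seq x v.1)) := by
      intro x
      have hne : {w | seq x w = x}.Nonempty := hlong x x.2
      refine ⟨⟨WellFounded.min wellFounded_lt _ hne,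
        fun t => f (insert x.1 (t.image fun v => seq x v.1))⟩,
        WellFounded.min_mem (wellFounded_lt (α := W)) _ hne, fun v hv hv' => ?_, fun t => rfl⟩
      exact WellFounded.not_lt_min (wellFounded_lt (α := W)) {w | seq x w = x} hv' hv
    choose p hp1 hp2 hp3 using hcode
    have hinj : Function.Injective p := by
      intro x y hxy
      have hy1 := hp1 y
      have hy2 := hp2 y
      have hy3 := hp3 y
      rw [← hxy] at hy1 hy2 hy3
      have hagree : ∀ v, v ≤ (p x).1 → seq x v = seq y v := by
        intro v
        induction v using WellFoundedLT.induction with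
        | ind v ih =>
        intro hv
        have hxA : x.1 ∈ A x v := hself x x.2 v fun u hu => hp2 x u (hu.trans_le hv)
        have hyA : y.1 ∈ A y v := hself y y.2 v fun u hu => hy2 u (hu.trans_le hv)
        have hAA : A x v = A y v := by
          have him : ∀ t : Finset (Set.Iio v), (t.image fun u => seq x u.1) =
              t.image fun u => seq y u.1 := fun t =>
            Finset.image_congr fun u _ => ih u.1 u.2 (u.2.le.trans hv)
          have hcol : ∀ t : Finset (Set.Iio v), f (insert x.1 (t.image fun u => seq x u.1)) =
              f (insert y.1 (t.image fun u => seq y u.1)) := by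
            intro t
            let inc : Set.Iio v → Set.Iio (p x).1 := fun u => ⟨u.1, lt_of_lt_of_le u.2 hv⟩
            have h1 := hp3 x (t.image inc)
            have h2 := hy3 (t.image inc)
            rw [Finset.image_image] at h1 h2
            exact h1.symm.trans h2
          ext z
          refine and_congr Iff.rfl (and_congr ?_ ?_)
          · refine forall_congr' fun u => forall_congr' fun hu => ?_
            change seq x u < z ↔ seq y u < z
            rw [ih u hu (hu.le.trans hv)]
          · refine forall_congr' fun t => ?_
            change f (insert z (t.image fun u => seq x u.1)) =
              f (insert x.1 (t.image fun u => seq x u.1)) ↔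
              f (insert z (t.image fun u => seq y u.1)) =
              f (insert y.1 (t.image fun u => seq y u.1))
            rw [hcol t, him t]
        exact (hleast x v hxA).unique (hAA ▸ hleast y v hyA)
      have := hagree _ le_rfl
      rw [hp1 x, hy1] at this
      exact Subtype.ext this
    exact absurd ((Cardinal.mk_le_of_injective hinj).trans (mk_sigma_initial_le hσ hC))
      (not_le.2 hY)

end EndHomogeneous

/-! ### Morley's method -/

section Template

/-- Pigeonhole for cofinal families of ordinals below a regular cardinal. -/
theorem exists_cofinal_colour {C : Type u} {ν : Cardinal.{u}} (hν : ν.IsRegular) (hC : #C < ν)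
    (col : Ordinal.{u} → C) :
    ∃ a, ∀ α < ν.ord, ∃ β < ν.ord, α ≤ β ∧ col β = a := by
  by_contra! h
  choose α hα hβ using h
  have hs : (⨆ a, α a) < ν.ord := Ordinal.iSup_lt_of_lt_cof (by rwa [hν.cof_ord]) hα
  exact hβ (col (⨆ a, α a)) _ hs (Ordinal.le_iSup α _) rfl

/-- Morley's method: a colouring of the finite subsets of a set of size `ℶ_{(2 ^ μ)⁺}` by `2 ^ μ`
colours has arbitrarily large finite sets on which the colour depends only, and coherently, on
the number of elements. -/
theorem exists_template {X C : Type u} [LinearOrder X] [WellFoundedLT X] (f : Finset X → C)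
    {μ : Cardinal.{u}} (hμ : ℵ₀ ≤ μ) (hC : #C ≤ 2 ^ μ)
    (hX : beth (Order.succ ((2 : Cardinal.{u}) ^ μ)).ord ≤ #X) :
    ∃ c : ℕ → C, ∀ n, ∃ s : Finset X, s.card = n ∧ ∀ t ⊆ s, f t = c t.card := by
  classical
  set ν := Order.succ ((2 : Cardinal.{u}) ^ μ) with hνdef
  have h2 : ℵ₀ ≤ (2 : Cardinal.{u}) ^ μ := hμ.trans (Cardinal.cantor μ).le
  have hν : ν.IsRegular := Cardinal.isRegular_succ h2
  have hlim : Order.IsSuccLimit ν.ord := Cardinal.isSuccLimit_ord hν.aleph0_le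
  have hμν : μ.ord < ν.ord :=
    Cardinal.ord_lt_ord.2 ((Cardinal.cantor μ).trans (Order.lt_succ _))
  -- Invariant: on sets of size at least `beth α`, for each `α < ν.ord`, the last `n` points do not
  -- affect the colour, and sets of fewer than `n` points already have their final colour.
  let Good : ℕ → (ℕ → C) → Prop := fun n c => ∀ α < ν.ord, ∃ Y : Set X, beth α ≤ #Y ∧
    ∃ g : Finset X → C, (∀ t s : Finset X, ↑t ⊆ Y → ↑s ⊆ Y → s.card = n →
      (∀ x ∈ t, ∀ y ∈ s, x < y) → f (t ∪ s) = g t) ∧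
      ∀ s : Finset X, ↑s ⊆ Y → s.card < n → f s = c s.card
  have hzero : Good 0 fun _ => f ∅ := by
    intro α hα
    refine ⟨Set.univ, ?_, f, ?_, ?_⟩
    · rw [Cardinal.mk_univ]
      exact (beth_mono hα.le).trans hX
    · intro t s _ _ hs _
      rw [Finset.card_eq_zero.1 hs, Finset.union_empty]
    · intro s _ hs
      omega
  have hstep : ∀ n c, Good n c → ∃ a, Good (n + 1) (Function.update c n a) := by
    intro n c hgood
    have hnew : ∀ α < ν.ord, ∃ a, ∃ Y : Set X, beth α ≤ #Y ∧
        ∃ g : Finset X → C, (∀ t s : Finset X, ↑t ⊆ Y → ↑s ⊆ Y → s.card = n + 1 →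
          (∀ x ∈ t, ∀ y ∈ s, x < y) → f (t ∪ s) = g t) ∧
          ∀ s : Finset X, ↑s ⊆ Y → s.card < n + 1 → f s = Function.update c n a s.card := by
      intro α hα
      -- Starting from size ℶ_{β+2} > 2^{ℶ_β} leaves more than ℶ_β points after one use of
      -- end-homogeneity; `β ≥ μ.ord` bounds the number of colours by 2^{ℶ_β}.
      set β := max α μ.ord with hβ
      have hβν : β < ν.ord := max_lt hα hμν
      obtain ⟨Y, hYc, g, hg, hc⟩ := hgood _ (hlim.succ_lt (hlim.succ_lt hβν))
      have hμβ : μ ≤ beth β := (le_beth_ord μ).trans (beth_mono (le_max_right _ _))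
      obtain ⟨Z, hZY, hZ, g', hg'⟩ := exists_endHomogeneous g Y (aleph0_le_beth β)
        (hC.trans (Cardinal.power_le_power_left two_ne_zero hμβ)) (by
          refine lt_of_lt_of_le ?_ hYc
          rw [← beth_succ]
          exact beth_strictMono (Order.lt_succ _))
      refine ⟨g ∅, Z, (beth_mono (le_max_left _ _)).trans hZ.le, g', ?_, ?_⟩
      · intro t s ht hs hcard hts
        have hsne : s.Nonempty := Finset.card_pos.1 (by omega)
        -- Moving the least point of `s` over to `t` leaves `n` points above, to which the old
        -- invariant applies.
        set z := s.min' hsne with hz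
        have hzs : z ∈ s := Finset.min'_mem _ _
        have hunion : t ∪ s = insert z t ∪ s.erase z := by
          ext x
          simp only [Finset.mem_union, Finset.mem_insert, Finset.mem_erase]
          by_cases hx : x = z
          · simp [hx, hzs]
          · simp [hx]
        rw [hunion, hg (insert z t) (s.erase z) ?_ ?_ ?_ ?_]
        · exact hg' t ht z (hs hzs) fun x hx => hts x hx z hzs
        · rw [Finset.coe_insert]
          exact Set.insert_subset (hZY (hs hzs)) (ht.trans hZY)
        · exact (Finset.coe_subset.2 (Finset.erase_subset _ _)).trans (hs.trans hZY)
        · rw [Finset.card_erase_of_mem hzs]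
          omega
        · intro x hx y hy
          obtain ⟨hyz, hys⟩ := Finset.mem_erase.1 hy
          rcases Finset.mem_insert.1 hx with rfl | hx
          · exact lt_of_le_of_ne (Finset.min'_le _ _ hys) (Ne.symm hyz)
          · exact hts x hx y hys
      · intro s hs hcard
        rcases (Nat.lt_succ_iff.1 hcard).lt_or_eq with hlt | heq
        · rw [hc s (hs.trans hZY) hlt, Function.update_of_ne hlt.ne]
        · rw [heq, Function.update_self]
          have := hg ∅ s (by simp) (hs.trans hZY) heq (by simp)
          rwa [Finset.empty_union] at this
    -- The new colour depends on `α`; the pigeonhole below the regular ν then finds one that recurs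
    -- cofinally. From `ν.ord` on the choice is a dummy.
    have : ∀ α, ∃ a, α < ν.ord → ∃ Y : Set X, beth α ≤ #Y ∧
        ∃ g : Finset X → C, (∀ t s : Finset X, ↑t ⊆ Y → ↑s ⊆ Y → s.card = n + 1 →
          (∀ x ∈ t, ∀ y ∈ s, x < y) → f (t ∪ s) = g t) ∧
          ∀ s : Finset X, ↑s ⊆ Y → s.card < n + 1 →
            f s = Function.update c n a s.card := by
      intro α
      by_cases hα : α < ν.ord
      · obtain ⟨a, ha⟩ := hnew α hα
        exact ⟨a, fun _ => ha⟩
      · exact ⟨f ∅, fun h => absurd h hα⟩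
    choose col hcol using this
    obtain ⟨a, ha⟩ := exists_cofinal_colour hν (hC.trans_lt (Order.lt_succ _)) col
    refine ⟨a, fun α hα => ?_⟩
    obtain ⟨β, hβ, hαβ, rfl⟩ := ha α hα
    obtain ⟨Y, hY, h⟩ := hcol β hβ
    exact ⟨Y, (beth_mono hαβ).trans hY, h⟩
  have hne : Nonempty C := ⟨f ∅⟩
  choose! nxt hnxt using hstep
  let d : ∀ n, {c // Good n c} := fun n => Nat.rec
    (motive := fun n => {c // Good n c}) ⟨fun _ => f ∅, hzero⟩
    (fun n c => ⟨Function.update c.1 n (nxt n c.1), hnxt n c.1 c.2⟩) n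
  have hd : ∀ n, (d (n + 1)).1 = Function.update (d n).1 n (nxt n (d n).1) := fun n => rfl
  have hstable : ∀ n, ∀ k < n, (d n).1 k = (d (k + 1)).1 k := by
    intro n
    induction n with
    | zero => intro k hk; omega
    | succ n ih =>
      intro k hk
      rcases (Nat.lt_succ_iff.1 hk).lt_or_eq with hlt | rfl
      · rw [hd, Function.update_of_ne hlt.ne, ih k hlt]
      · rfl
  -- The value at `k` is fixed at stage `k + 1` and never changes; at the end an infinite set, the
  -- case `α = 0`, is enough.
  refine ⟨fun k => (d (k + 1)).1 k, fun n => ?_⟩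
  obtain ⟨Y, hY, -, -, hc⟩ := (d (n + 1)).2 0 hlim.bot_lt
  have hYinf : Y.Infinite := by
    rw [← Set.infinite_coe_iff, Cardinal.infinite_iff]
    exact (aleph0_le_beth 0).trans hY
  obtain ⟨s, hs, hcard⟩ := hYinf.exists_subset_card_eq n
  refine ⟨s, hcard, fun t hts => ?_⟩
  have hlt : t.card < n + 1 := by
    have := Finset.card_le_card hts
    omega
  rw [hc t ((Finset.coe_subset.2 hts).trans hs) hlt, hstable _ _ hlt]

/-- A finite linear order is mapped increasingly onto any finite subset of the same size. -/
theorem exists_strictMonoOn_image {I X : Type u} [LinearOrder I] [LinearOrder X] [Nonempty X]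
    (t : Finset I) (s : Finset X) (h : s.card = t.card) :
    ∃ b : I → X, StrictMonoOn b t ∧ t.image b = s := by
  classical
  let φ : t ≃o s := (t.orderIsoOfFin rfl).symm.trans (s.orderIsoOfFin h)
  refine ⟨fun i => if h : i ∈ t then φ ⟨i, h⟩ else Classical.arbitrary X, ?_, ?_⟩
  · intro i hi j hj hij
    have hi' : i ∈ t := hi
    have hj' : j ∈ t := hj
    simp only [hi', hj', dif_pos]
    exact φ.strictMono (a := ⟨i, hi'⟩) (b := ⟨j, hj'⟩) hij
  · ext x
    rw [Finset.mem_image]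
    constructor
    · rintro ⟨i, hi, rfl⟩
      rw [dif_pos hi]
      exact (φ ⟨i, hi⟩).2
    · intro hx
      refine ⟨φ.symm ⟨x, hx⟩, (φ.symm ⟨x, hx⟩).2, ?_⟩
      rw [dif_pos (φ.symm ⟨x, hx⟩).2]
      simp

end Template

/-! ### Diagrams of enumerated structures -/

section Diagram

variable {L : FirstOrder.Language.{u, u}} {X M M' : Type u} [L.Structure M] [L.Structure M']

/-- The set of all formulas satisfied by a family of elements of a structure. -/
def diagram (L : FirstOrder.Language.{u, u}) {X M : Type u} [L.Structure M] (e : X → M) :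
    Set (L.Formula X) :=
  {φ | φ.Realize e}

theorem mk_diagram_le {ν : Cardinal.{u}} (hν : ℵ₀ ≤ ν) (hL : L.card ≤ ν) (hX : #X ≤ ν) :
    #(Set (L.Formula X)) ≤ 2 ^ ν := by
  rw [Cardinal.mk_set]
  refine Cardinal.power_le_power_left two_ne_zero ?_
  have h1 : #(L.Formula X) ≤ #(Σ n, L.BoundedFormula X n) := by
    refine Cardinal.mk_le_of_injective (f := fun φ => ⟨0, φ⟩) fun φ ψ h => ?_
    simpa using h
  refine h1.trans (BoundedFormula.card_le.trans (max_le hν ?_))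
  rw [Cardinal.lift_id, Cardinal.lift_id]
  exact Cardinal.add_le_of_le hν hX hL

theorem eq_iff_of_diagram_eq {e : X → M} {e' : X → M'} (h : diagram L e = diagram L e') (x y : X) :
    e x = e y ↔ e' x = e' y := by
  have := Set.ext_iff.1 h ((Term.var x).equal (Term.var y))
  simpa [diagram, Formula.realize_equal] using this

/-- Two enumerations of structures with the same diagram induce an isomorphism. -/
theorem exists_equiv_of_diagram_eq {e : X → M} {e' : X → M'} (he : Function.Surjective e)
    (he' : Function.Surjective e') (h : diagram L e = diagram L e') :
    ∃ φ : M ≃[L] M', ∀ x, φ (e x) = e' x := by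
  have key := eq_iff_of_diagram_eq h
  let φ : M ≃ M' :=
    { toFun := fun m => e' (Function.surjInv he m)
      invFun := fun m => e (Function.surjInv he' m)
      left_inv := fun m => by
        have := (key _ _).2 (Function.surjInv_eq he' (e' (Function.surjInv he m)))
        exact this.trans (Function.surjInv_eq he m)
      right_inv := fun m => by
        have := (key _ _).1 (Function.surjInv_eq he (e (Function.surjInv he' m)))
        exact this.trans (Function.surjInv_eq he' m) }
  have hφ : ∀ x, φ (e x) = e' x := fun x => (key _ _).1 (Function.surjInv_eq he (e x))
  refine ⟨{ φ with map_fun' := ?_, map_rel' := ?_ }, hφ⟩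
  · intro n F xs
    change φ _ = Structure.funMap F (φ ∘ xs)
    obtain ⟨z, hz⟩ := he (Structure.funMap F xs)
    choose ys hys using fun i => he (xs i)
    obtain rfl : (fun i => e (ys i)) = xs := funext hys
    have hcomp : φ ∘ (fun i => e (ys i)) = fun i => e' (ys i) := funext fun i => hφ _
    have := Set.ext_iff.1 h ((Term.var z).equal (Term.func F fun i => Term.var (ys i)))
    simp only [diagram, Set.mem_ofPred_eq, Formula.realize_equal, Term.realize_var,
      Term.realize_func] at this
    rw [hcomp, ← this.1 hz, ← hz, hφ]
  · intro n R xs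
    change Structure.RelMap R (φ ∘ xs) ↔ _
    choose ys hys using fun i => he (xs i)
    obtain rfl : (fun i => e (ys i)) = xs := funext hys
    have hcomp : φ ∘ (fun i => e (ys i)) = fun i => e' (ys i) := funext fun i => hφ _
    have := Set.ext_iff.1 h (R.formula fun i => Term.var (ys i))
    simp only [diagram, Set.mem_ofPred_eq, Formula.realize_rel, Term.realize_var] at this
    rw [hcomp]
    exact this.symm

end Diagram

/-! ### Model-homogeneous extensions -/

namespace AEC
variable {L : FirstOrder.Language.{u, u}} (K : AEC L)

/-- A model whose universe is a subset of `U`. -/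
structure SubModel (U : Type u) where
  carrier : Set U
  [str : L.Structure carrier]
  isModel : K.IsModel carrier

attribute [instance] SubModel.str

namespace SubModel

variable {K} {U : Type u}

/-- The order is designed for Zorn's lemma: an increasing family is bounded by its union, which is
still inside `U`. -/
instance : Preorder (K.SubModel U) where
  le x y := ∃ g : x.carrier ↪[L] y.carrier, K.IsEmb g ∧ ∀ u, (g u : U) = u
  le_refl x := ⟨Embedding.refl L _, K.isEmb_refl x.isModel, fun _ => rfl⟩
  le_trans x y z := by
    rintro ⟨g, hg, hgu⟩ ⟨h, hh, hhu⟩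
    exact ⟨h.comp g, hh.comp hg, fun u => (hhu _).trans (hgu u)⟩

/-- A copy of `P` can be placed inside `U` by an injection. -/
theorem exists_ofInjective {P : Type u} [L.Structure P] (hP : K.IsModel P) (ψ : P → U)
    (hψ : Function.Injective ψ) : ∃ y : K.SubModel U, y.carrier = Set.range ψ ∧
      ∃ φ : P ≃[L] y.carrier, ∀ p, (φ p : U) = ψ p := by
  let _ : L.Structure (Set.range ψ) := (Equiv.ofInjective ψ hψ).inducedStructure
  let φ : P ≃[L] Set.range ψ := (Equiv.ofInjective ψ hψ).inducedStructureEquiv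
  exact ⟨⟨Set.range ψ, K.isModel_iso φ hP⟩, rfl, φ, fun p => rfl⟩

/-- Directed families of models inside `U` are bounded by their union. -/
theorem exists_directed_bound {ι : Type u} [Preorder ι] [Nonempty ι] [IsDirectedOrder ι]
    (F : ι → K.SubModel U) (hF : Monotone F) :
    ∃ y : K.SubModel U, (∀ i, F i ≤ y) ∧ y.carrier = ⋃ i, (F i).carrier := by
  choose g hg hgu using fun (i j : ι) (h : i ≤ j) => hF h
  have hdir : DirectedSystem (fun i => (F i).carrier) fun i j h => g i j h :=
    ⟨fun i x => Subtype.ext (hgu _ _ _ _), fun i j k hij hjk x => Subtype.ext (by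
      rw [hgu, hgu, hgu])⟩
  obtain ⟨hlim, hof⟩ := K.directLimit g hg
  set W := Language.DirectLimit (fun i => (F i).carrier) g
  have hex : ∀ w : W, ∃ u : U, ∃ i, ∃ x : (F i).carrier, DirectLimit.of L ι _ g i x = w ∧ x.1 = u := by
    intro w
    obtain ⟨i, x, hx⟩ := DirectLimit.exists_of w
    exact ⟨x, i, x, hx, rfl⟩
  have heq : ∀ i (x : (F i).carrier) j (y : (F j).carrier),
      DirectLimit.of L ι _ g i x = DirectLimit.of L ι _ g j y ↔ x.1 = y.1 := by
    intro i x j y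
    obtain ⟨k, hik, hjk⟩ := exists_ge_ge i j
    rw [← DirectLimit.of_f (f := g) (hij := hik) (x := x),
      ← DirectLimit.of_f (f := g) (hij := hjk) (x := y),
      (DirectLimit.of L ι _ g k).injective.eq_iff, Subtype.ext_iff, hgu, hgu]
  -- Representatives of a class share one underlying point of `U`, so ψ puts the limit back into `U`
  -- injectively.
  choose ψ hψ using hex
  have hψof : ∀ i (x : (F i).carrier), ψ (DirectLimit.of L ι _ g i x) = x := by
    intro i x
    obtain ⟨j, y, hy, hyu⟩ := hψ (DirectLimit.of L ι _ g i x)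
    rw [← hyu]
    exact (heq _ _ _ _).1 hy
  have hψinj : Function.Injective ψ := by
    intro w w' h
    obtain ⟨i, x, rfl⟩ := DirectLimit.exists_of w
    obtain ⟨j, y, rfl⟩ := DirectLimit.exists_of w'
    rw [hψof, hψof] at h
    exact (heq _ _ _ _).2 h
  obtain ⟨y, hy, φ, hφ⟩ := exists_ofInjective hlim ψ hψinj
  refine ⟨y, fun i => ⟨φ.toEmbedding.comp (DirectLimit.of L ι _ g i), (hof i).equiv_comp φ,
    fun u => (hφ _).trans (hψof i u)⟩, ?_⟩
  rw [hy]
  ext u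
  rw [Set.mem_iUnion]
  constructor
  · rintro ⟨w, rfl⟩
    obtain ⟨i, x, rfl⟩ := DirectLimit.exists_of w
    exact ⟨i, by rw [hψof]; exact x.2⟩
  · rintro ⟨i, hi⟩
    exact ⟨_, hψof i ⟨u, hi⟩⟩

/-- An extension of `x` can be placed inside `U` over `x` when there is room. -/
theorem exists_extension (x : K.SubModel U) {P : Type u} [L.Structure P] {p : x.carrier ↪[L] P}
    (hp : K.IsEmb p) {B : Set U} (hB : Disjoint x.carrier B) (hPB : #P ≤ #B) :
    ∃ y : K.SubModel U, x ≤ y ∧ y.carrier ⊆ x.carrier ∪ B ∧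
      ∃ φ : P ≃[L] y.carrier, ∀ u, (φ (p u) : U) = u := by
  classical
  obtain ⟨inj⟩ := hPB
  let ψ : P → U := fun q => if h : ∃ u, p u = q then (h.choose : U) else (inj q : U)
  have hψp : ∀ u, ψ (p u) = u := by
    intro u
    have h : ∃ u', p u' = p u := ⟨u, rfl⟩
    have : ψ (p u) = (h.choose : U) := dif_pos h
    rw [this, p.injective h.choose_spec]
  have hψB : ∀ q, (¬ ∃ u, p u = q) → ψ q = inj q := fun q h => dif_neg h
  have hψinj : Function.Injective ψ := by
    intro q r hqr
    by_cases hq : ∃ u, p u = q <;> by_cases hr : ∃ u, p u = r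
    · obtain ⟨u, rfl⟩ := hq
      obtain ⟨v, rfl⟩ := hr
      rw [hψp, hψp] at hqr
      rw [Subtype.ext hqr]
    · obtain ⟨u, rfl⟩ := hq
      rw [hψp, hψB r hr] at hqr
      exact (Set.disjoint_left.1 hB u.2 (hqr ▸ (inj r).2)).elim
    · obtain ⟨v, rfl⟩ := hr
      rw [hψp, hψB q hq] at hqr
      exact (Set.disjoint_left.1 hB v.2 (hqr ▸ (inj q).2)).elim
    · rw [hψB q hq, hψB r hr] at hqr
      exact inj.injective (Subtype.ext hqr)
  obtain ⟨y, hy, φ, hφ⟩ := exists_ofInjective hp.isModel_right ψ hψinj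
  refine ⟨y, ⟨φ.toEmbedding.comp p, hp.equiv_comp φ, fun u => (hφ _).trans (hψp u)⟩, ?_, φ,
    fun u => (hφ _).trans (hψp u)⟩
  rw [hy]
  rintro _ ⟨q, rfl⟩
  by_cases hq : ∃ u, p u = q
  · obtain ⟨u, rfl⟩ := hq
    rw [hψp]
    exact Or.inl u.2
  · rw [hψB q hq]
    exact Or.inr (inj q).2

end SubModel

/-- `M` is `κ`-model-homogeneous: every extension of size `< κ` of a strong substructure of `M`
embeds into `M` over that substructure. -/
def ModelHomogeneous (κ : Cardinal.{u}) (M : Type u) [L.Structure M] : Prop :=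
  ∀ (N N' : Type u) [L.Structure N] [L.Structure N'] (f : N ↪[L] M) (g : N ↪[L] N'),
    K.IsEmb f → K.IsEmb g → #N' < κ → ∃ h : N' ↪[L] M, K.IsEmb h ∧ h.comp g = f

theorem ModelHomogeneous.congr {K : AEC L} {κ : Cardinal.{u}} {M M' : Type u} [L.Structure M]
    [L.Structure M'] (h : K.ModelHomogeneous κ M) (e : M ≃[L] M') :
    K.ModelHomogeneous κ M' := by
  intro N N' _ _ f g hf hg hN'
  obtain ⟨k, hk, hkg⟩ := h N N' (e.symm.toEmbedding.comp f) g (hf.equiv_comp _) hg hN'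
  refine ⟨e.toEmbedding.comp k, hk.equiv_comp e, ?_⟩
  ext x
  have := congrArg e (DFunLike.congr_fun hkg x)
  exact this.trans (e.apply_symm_apply (f x))

/-- Codes for extensions of small submodels of models inside `U`. -/
abbrev ExtCode (L : FirstOrder.Language.{u, u}) (κ : Cardinal.{u}) (U : Type u) : Type u :=
  Σ i : κ.ord.ToType, (Set.Iio i → U) × Set (L.Formula (Set.Iio i ⊕ Set.Iio i))

/-- This is where `θ ^ ν ≤ θ` is spent: there are at most θ choices of fewer than `κ` parameters in
`U`, and at most 2^ν ≤ θ^ν diagrams. -/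
theorem mk_extCode_le {κ θ : Cardinal.{u}} (hκ : ℵ₀ ≤ κ) (hL : L.card < κ) (hθ : κ ≤ θ)
    (hpow : ∀ ν < κ, θ ^ ν ≤ θ) {U : Type u} (hU : #U ≤ θ) (hω : ℵ₀ < κ) :
    #(ExtCode L κ U) ≤ θ := by
  have hθω : ℵ₀ ≤ θ := hκ.trans hθ
  have h1 : ∀ i : κ.ord.ToType,
      #((Set.Iio i → U) × Set (L.Formula (Set.Iio i ⊕ Set.Iio i))) ≤ θ := by
    intro i
    have hi : #(Set.Iio i) < κ := by
      have := Cardinal.mk_Iio_lt i (by simp)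
      rwa [Cardinal.mk_ord_toType] at this
    rw [Cardinal.mk_prod, Cardinal.lift_id, Cardinal.lift_id]
    refine Cardinal.mul_le_of_le hθω ?_ ?_
    · rw [← Cardinal.power_def]
      exact (Cardinal.power_le_power_right hU).trans (hpow _ hi)
    · let ν := max (max ℵ₀ L.card) (#(Set.Iio i) + #(Set.Iio i))
      have hν : ν < κ := max_lt (max_lt hω hL) (Cardinal.add_lt_of_lt hκ hi hi)
      have := mk_diagram_le (L := L) (X := Set.Iio i ⊕ Set.Iio i) (ν := ν)
        ((le_max_left _ _).trans (le_max_left _ _)) ((le_max_right _ _).trans (le_max_left _ _))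
        (by simpa only [Cardinal.mk_sum, Cardinal.lift_id] using le_max_right _ _)
      refine this.trans (le_trans ?_ (hpow ν hν))
      exact Cardinal.power_le_power_right ((Cardinal.natCast_lt_aleph0 (n := 2)).le.trans hθω)
  rw [ExtCode, Cardinal.mk_sigma]
  refine (Cardinal.sum_le_sum _ _ h1).trans ?_
  rw [Cardinal.sum_const', Cardinal.mk_ord_toType]
  exact Cardinal.mul_le_of_le hθω hθ le_rfl

/-- The extension coded by `c` embeds into `x`. -/
def Realizes {κ : Cardinal.{u}} {U : Type u} (c : ExtCode L κ U) (x : K.SubModel U) : Prop :=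
  ∃ (N : Type u) (_ : L.Structure N) (e : Set.Iio c.1 ⊕ Set.Iio c.1 → N) (h : N ↪[L] x.carrier),
    Function.Surjective e ∧ K.IsEmb h ∧ (∀ v, (h (e (Sum.inl v)) : U) = c.2.1 v) ∧
      diagram L e = c.2.2

theorem Realizes.mono {K : AEC L} {κ : Cardinal.{u}} {U : Type u} {c : ExtCode L κ U}
    {x y : K.SubModel U} (h : K.Realizes c x) (hxy : x ≤ y) : K.Realizes c y := by
  obtain ⟨N, _, e, h, he, hh, hu, hd⟩ := h
  obtain ⟨g, hg, hgu⟩ := hxy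
  exact ⟨N, _, e, g.comp h, he, hg.comp hh, fun v => (hgu _).trans (hu v), hd⟩

theorem exists_mk_Iio_eq {κ ν : Cardinal.{u}} (h : ν < κ) :
    ∃ i : κ.ord.ToType, #(Set.Iio i) = ν := by
  refine ⟨Ordinal.ToType.mk ⟨ν.ord, Cardinal.ord_lt_ord.2 h⟩, ?_⟩
  have := Ordinal.card_typein (r := ((· < ·) : κ.ord.ToType → κ.ord.ToType → Prop))
    (Ordinal.ToType.mk ⟨ν.ord, Cardinal.ord_lt_ord.2 h⟩)
  refine this.symm.trans ?_
  refine (congrArg Ordinal.card (congrArg Subtype.val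
    (Ordinal.ToType.mk.symm_apply_apply ⟨ν.ord, Cardinal.ord_lt_ord.2 h⟩))).trans ?_
  exact Cardinal.card_ord ν

/-- Every model has a `κ`-model-homogeneous extension of size `≤ θ` when `θ = θ ^< κ`. -/
theorem exists_modelHomogeneous_extension
    (hinf : ∀ (M : Type u) [L.Structure M], K.IsModel M → ℵ₀ ≤ #M) (hAP : K.Amalgamation)
    {κ θ : Cardinal.{u}} (hκ : K.LS < κ) (hpow : ∀ ν < κ, θ ^ ν ≤ θ)
    (M : Type u) [L.Structure M] (hM : K.IsModel M) (hMθ : #M ≤ θ) :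
    ∃ (C : Type u) (_ : L.Structure C) (j : M ↪[L] C), K.IsEmb j ∧ #C ≤ θ ∧
      K.ModelHomogeneous κ C := by
  have hθω : ℵ₀ ≤ θ := (hinf M hM).trans hMθ
  have hκθ : κ ≤ θ := by
    refine le_of_forall_lt fun ν hν => lt_of_lt_of_le (Cardinal.cantor ν) ?_
    exact (Cardinal.power_le_power_right ((Cardinal.natCast_lt_aleph0 (n := 2)).le.trans hθω)).trans
      (hpow ν hν)
  have hκω : ℵ₀ < κ := K.aleph0_le_LS.trans_lt hκ
  have hLSθ : K.LS ≤ θ := hκ.le.trans hκθ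
  induction θ using Cardinal.inductionOn with | mk A
  -- `U` consists of θ columns of size θ; `j` reserves one for `M` and one for each code, so room
  -- never runs out. Codes take parameters anywhere in `U`, hence cover in advance every problem
  -- over the final model: no iteration of length `κ` is needed, and `κ` may be singular.
  let U := A × A
  have hU : #U ≤ #A := by
    rw [Cardinal.mk_prod, Cardinal.lift_id, Cardinal.mul_eq_self hθω]
  let T := ExtCode L κ U
  have hT : #(Option T) ≤ #A := by
    rw [Cardinal.mk_option]
    exact Cardinal.add_le_of_le hθω
      (mk_extCode_le hκω.le (K.card_le_LS.trans_lt hκ) hκθ hpow hU hκω)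
      (Cardinal.one_lt_aleph0.le.trans hθω)
  obtain ⟨j⟩ := hT
  -- The second component lists the codes already treated; only their columns and that of `M` are in
  -- use.
  let Valid : K.SubModel U × Set T → Prop := fun p =>
    (∀ u ∈ p.1.carrier, u.1 = j none ∨ ∃ c ∈ p.2, u.1 = j (some c)) ∧
      ∀ c ∈ p.2, K.Realizes c p.1
  obtain ⟨inM⟩ := hMθ
  obtain ⟨x₀, hx₀, φ₀, -⟩ := SubModel.exists_ofInjective (U := U) hM
    (fun m => (j none, inM m)) (fun m m' h => inM.injective (Prod.ext_iff.1 h).2)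
  have hV₀ : Valid (x₀, ∅) := by
    refine ⟨fun u hu => Or.inl ?_, fun c hc => hc.elim⟩
    rw [hx₀] at hu
    obtain ⟨m, rfl⟩ := hu
    rfl
  obtain ⟨⟨⟨x, D⟩, hV⟩, hx₀x, hmax⟩ := zorn_le_nonempty_Ici₀ (α := {p // Valid p})
    ⟨(x₀, ∅), hV₀⟩ (by
      intro c _ hc y hy
      have : Nonempty c := ⟨⟨y, hy⟩⟩
      have : IsDirectedOrder c := ⟨fun a b => (hc.total a.2 b.2).elim
        (fun h => ⟨b, h, le_rfl⟩) fun h => ⟨a, le_rfl, h⟩⟩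
      obtain ⟨z, hz, hzc⟩ := SubModel.exists_directed_bound (fun p : c => p.1.1.1)
        fun p q h => (show p.1.1 ≤ q.1.1 from h).1
      refine ⟨⟨(z, ⋃ p : c, p.1.1.2), ?_, ?_⟩, fun p hp => ⟨hz ⟨p, hp⟩, ?_⟩⟩
      · intro u hu
        rw [hzc] at hu
        obtain ⟨p, hp⟩ := Set.mem_iUnion.1 hu
        rcases p.1.2.1 u hp with h | ⟨d, hd, h⟩
        · exact Or.inl h
        · exact Or.inr ⟨d, Set.mem_iUnion.2 ⟨p, hd⟩, h⟩
      · intro d hd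
        obtain ⟨p, hp⟩ := Set.mem_iUnion.1 hd
        exact (p.1.2.2 d hp).mono (hz p)
      · exact Set.subset_iUnion (fun p : c => p.1.1.2) ⟨p, hp⟩) ⟨(x₀, ∅), hV₀⟩ le_rfl
  obtain ⟨g₀, hg₀, -⟩ : x₀ ≤ x := hx₀x.1
  have hxA : #x.carrier ≤ #A := (Cardinal.mk_set_le _).trans hU
  refine ⟨x.carrier, _, g₀.comp φ₀.toEmbedding, hg₀.comp_equiv φ₀, hxA, ?_⟩
  intro N N' _ _ f g hf hg hN'
  obtain ⟨i, hi⟩ := exists_mk_Iio_eq hN'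
  obtain ⟨s'⟩ : Nonempty (Set.Iio i ≃ N') := Cardinal.eq.1 hi
  have : Nonempty N := Cardinal.mk_ne_zero_iff.1
    (Cardinal.aleph0_pos.trans_le (hinf N hf.isModel_left)).ne'
  -- Points outside the range of `g` get arbitrary values of `invFun`; this is harmless because `e₀`
  -- and the code `c` use the same `s`.
  let s : Set.Iio i → N := fun v => Function.invFun g (s' v)
  let e₀ : Set.Iio i ⊕ Set.Iio i → N' := Sum.elim (fun v => g (s v)) s'
  have he₀ : Function.Surjective e₀ := fun y => ⟨Sum.inr (s'.symm y), s'.apply_symm_apply y⟩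
  let c : T := ⟨i, fun v => f (s v), diagram L e₀⟩
  -- By maximality: otherwise an amalgam, cut down to size at most θ, would fit into the untouched
  -- column of `c`.
  have hcD : c ∈ D := by
    by_contra hc
    obtain ⟨P, _, p, q, hp, hq, hpq⟩ := hAP N x.carrier N' f g hf hg
    obtain ⟨R, hR, hRs, hRc⟩ := K.exists_hull_le hp.isModel_right
      (Set.range p ∪ Set.range q) hLSθ (by
        refine (Cardinal.mk_union_le _ _).trans (Cardinal.add_le_of_le hθω ?_ ?_)
        · exact Cardinal.mk_range_le.trans hxA
        · exact Cardinal.mk_range_le.trans (hN'.le.trans hκθ))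
    have hRe := K.isEmb_subtype hR
    have hpm : ∀ u, p u ∈ R := fun u => hRs (Or.inl ⟨u, rfl⟩)
    have hqm : ∀ u, q u ∈ R := fun u => hRs (Or.inr ⟨u, rfl⟩)
    have hp' : K.IsEmb (p.codRestrict R hpm) := IsEmb.of_comp hRe (by simpa using hp)
    have hq' : K.IsEmb (q.codRestrict R hqm) := IsEmb.of_comp hRe (by simpa using hq)
    let B : Set U := {u | u.1 = j (some c)}
    have hB : Disjoint x.carrier B := by
      rw [Set.disjoint_left]
      intro u hu huB
      rcases hV.1 u hu with h | ⟨d, hd, h⟩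
      · exact absurd (j.injective (h.symm.trans huB)) (by simp)
      · have := j.injective (h.symm.trans huB)
        rw [Option.some_inj] at this
        exact hc (this ▸ hd)
    have hBA : #A ≤ #B := Cardinal.mk_le_of_injective
      (f := fun a : A => (⟨(j (some c), a), rfl⟩ : B)) fun a a' h =>
        (Prod.ext_iff.1 (congrArg Subtype.val h)).2
    obtain ⟨y, hxy, hyc, φ, hφ⟩ := x.exists_extension hp' hB (hRc.trans hBA)
    have hVy : Valid (y, insert c D) := by
      refine ⟨fun u hu => ?_, fun d hd => ?_⟩
      · rcases hyc hu with hu | hu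
        · rcases hV.1 u hu with h | ⟨d, hd, h⟩
          · exact Or.inl h
          · exact Or.inr ⟨d, Or.inr hd, h⟩
        · exact Or.inr ⟨c, Or.inl rfl, hu⟩
      · rcases hd with rfl | hd
        · refine ⟨N', _, e₀, φ.toEmbedding.comp (q.codRestrict R hqm), he₀, hq'.equiv_comp φ,
            fun v => ?_, rfl⟩
          refine Eq.trans ?_ (hφ (f (s v)))
          refine congrArg (fun r : R => (φ r : U)) (Subtype.ext ?_)
          exact (DFunLike.congr_fun hpq (s v)).symm
        · exact (hV.2 d hd).mono hxy
    exact hc ((hmax (b := ⟨(y, insert c D), hVy⟩) ⟨hxy, Set.subset_insert _ _⟩).2 (Or.inl rfl))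
  obtain ⟨N₁, _, e, h, he, hh, hu, hd⟩ := hV.2 c hcD
  obtain ⟨φ, hφ⟩ := exists_equiv_of_diagram_eq he₀ he hd.symm
  refine ⟨h.comp φ.toEmbedding, hh.comp_equiv φ, ?_⟩
  refine DFunLike.ext _ _ fun n => ?_
  have hs : s (s'.symm (g n)) = n := by
    simp only [s, Equiv.apply_symm_apply]
    exact Function.leftInverse_invFun g.injective n
  have h1 := hφ (Sum.inl (s'.symm (g n)))
  have h2 := hu (s'.symm (g n))
  rw [← h1] at h2
  simp only [e₀, c, Sum.elim_inl, hs] at h2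
  exact Subtype.ext h2

end AEC

/-! ### From saturation to model-homogeneity -/

/-- If every task can be accomplished above every point, and short chains are bounded, then all
tasks can be accomplished simultaneously. -/
theorem exists_forall_of_chain_bounded {X : Type*} [Preorder X] {T : Type u} (P : T → X → Prop)
    (hmono : ∀ t x y, x ≤ y → P t x → P t y) (hstep : ∀ x t, ∃ y, x ≤ y ∧ P t y)
    (hchain : ∀ (J : Type u) [LinearOrder J] [Nonempty J], #J ≤ #T → ∀ F : J → X, Monotone F →
      ∃ y, ∀ j, F j ≤ y) (x : X) : ∃ y, x ≤ y ∧ ∀ t, P t y := by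
  classical
  let W := (#T).ord.ToType
  obtain ⟨e⟩ : Nonempty (W ≃ T) := Cardinal.eq.1 (by simp [W])
  have hbound : ∀ (J : Type u) [LinearOrder J], #J ≤ #T → ∀ F : J → X, Monotone F →
      (∀ j, x ≤ F j) → ∃ y, x ≤ y ∧ ∀ j, F j ≤ y := by
    intro J _ hJ F hF hx
    rcases isEmpty_or_nonempty J with hJe | hJe
    · exact ⟨x, le_rfl, fun j => hJe.elim j⟩
    · obtain ⟨y, hy⟩ := hchain J hJ F hF
      exact ⟨y, (hx (Classical.arbitrary J)).trans (hy _), hy⟩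
  -- The tasks are done in turn along `W`; `hspec` shows that the fallback `x` is never needed.
  let H : ∀ w : W, (∀ v : W, v < w → X) → X := fun w ih =>
    if h : ∃ y, x ≤ y ∧ (∀ v (hv : v < w), ih v hv ≤ y) ∧ P (e w) y then h.choose else x
  let F : W → X := WellFounded.fix wellFounded_lt H
  have hF : ∀ w, (∃ y, x ≤ y ∧ (∀ v < w, F v ≤ y) ∧ P (e w) y) →
      x ≤ F w ∧ (∀ v < w, F v ≤ F w) ∧ P (e w) (F w) := by
    intro w h
    have : F w = h.choose := by
      have h1 : F w = H w fun v _ => F v := WellFounded.fix_eq wellFounded_lt H w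
      rw [h1]
      exact dif_pos h
    rw [this]
    exact h.choose_spec
  have hspec : ∀ w, x ≤ F w ∧ (∀ v < w, F v ≤ F w) ∧ P (e w) (F w) := by
    intro w
    induction w using WellFoundedLT.induction with
    | ind w ih =>
    apply hF
    obtain ⟨y, hxy, hy⟩ := hbound (Set.Iio w)
      ((Cardinal.mk_set_le _).trans (Cardinal.mk_congr e).le) (fun v => F v)
      (fun u v huv => by
        rcases huv.lt_or_eq with h | h
        · exact (ih v.1 v.2).2.1 u.1 h
        · rw [h]) fun v => (ih v.1 v.2).1
    obtain ⟨z, hyz, hz⟩ := hstep y (e w)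
    exact ⟨z, hxy.trans hyz, fun v hv => (hy ⟨v, hv⟩).trans hyz, hz⟩
  obtain ⟨y, hxy, hy⟩ := hbound W (Cardinal.mk_congr e).le F (fun u v huv => by
    rcases huv.lt_or_eq with h | h
    · exact (hspec v).2.1 u h
    · rw [h]) fun v => (hspec v).1
  refine ⟨y, hxy, fun t => ?_⟩
  have := hmono _ _ _ (hy (e.symm t)) (hspec (e.symm t)).2.2
  rwa [e.apply_symm_apply] at this

theorem mk_iSup_directed_le {L : FirstOrder.Language.{u, u}} {J M : Type u} [L.Structure M]
    [Preorder J] [Nonempty J] [IsDirectedOrder J] {S : J → L.Substructure M} (hS : Monotone S)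
    {μ : Cardinal.{u}} (hμ : ℵ₀ ≤ μ) (hJ : #J ≤ μ) (hSμ : ∀ j, #(S j) ≤ μ) :
    #(⨆ j, S j : L.Substructure M) ≤ μ := by
  have hsurj : Function.Surjective
      (fun p : Σ j, S j => (⟨p.2.1, le_iSup S p.1 p.2.2⟩ : (⨆ j, S j : L.Substructure M))) := by
    rintro ⟨x, hx⟩
    obtain ⟨j, hj⟩ := (Substructure.mem_iSup_of_directed hS.directed_le).1 hx
    exact ⟨⟨j, x, hj⟩, rfl⟩
  refine (Cardinal.mk_le_of_surjective hsurj).trans ?_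
  rw [Cardinal.mk_sigma]
  refine (Cardinal.sum_le_sum _ _ hSμ).trans ?_
  rw [Cardinal.sum_const']
  exact Cardinal.mul_le_of_le hμ hJ le_rfl

namespace AEC
variable {L : FirstOrder.Language.{u, u}} (K : AEC L)

/-- Saturation for single elements, phrased by amalgams: types over strong substructures of size
`< κ` are realized in `M`. -/
def ElementSaturated (κ : Cardinal.{u}) (M : Type u) [L.Structure M] : Prop :=
  ∀ (N P : Type u) [L.Structure N] [L.Structure P] (f : N ↪[L] M) (g : N ↪[L] P) (a : P),
    K.IsEmb f → K.IsEmb g → #N < κ →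
    ∃ (b : M) (Q : Type u) (_ : L.Structure Q) (h : M ↪[L] Q) (k : P ↪[L] Q),
      K.IsEmb h ∧ K.IsEmb k ∧ h.comp f = k.comp g ∧ h b = k a

variable {K}

theorem IsEmb.codRestrict {N P : Type u} [L.Structure N] [L.Structure P] {f : N ↪[L] P}
    (hf : K.IsEmb f) {S : L.Substructure P} (hS : K.Strong S) (h : ∀ x, f x ∈ S) :
    K.IsEmb (f.codRestrict S h) :=
  IsEmb.of_comp (K.isEmb_subtype hS) (by simpa using hf)

/-- The point `a` lies in a strong submodel of size `< κ` containing the image of `N`, which embeds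
in `M` over `N`; amalgamating over it identifies `a` with its image. -/
theorem ModelHomogeneous.elementSaturated (hAP : K.Amalgamation) {κ : Cardinal.{u}}
    (hκ : K.LS < κ) {M : Type u} [L.Structure M] (h : K.ModelHomogeneous κ M) :
    K.ElementSaturated κ M := by
  intro N P _ _ f g a hf hg hN
  have hκω : ℵ₀ ≤ κ := K.aleph0_le_LS.trans hκ.le
  obtain ⟨R, hR, hRs, hRc⟩ := K.exists_hull_lt hg.isModel_right (insert a (Set.range g)) hκ (by
    refine Cardinal.mk_insert_le.trans_lt (Cardinal.add_lt_of_lt hκω ?_ ?_)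
    · exact Cardinal.mk_range_le.trans_lt hN
    · exact Cardinal.one_lt_aleph0.trans_le hκω)
  have hgR : ∀ x, g x ∈ R := fun x => hRs (Or.inr ⟨x, rfl⟩)
  obtain ⟨r, hr, hrg⟩ := h N R f (g.codRestrict R hgR) hf (hg.codRestrict hR hgR) hRc
  obtain ⟨Q, _, h', k, hh', hk, hhk⟩ := hAP R M P r R.subtype hr (K.isEmb_subtype hR)
  refine ⟨r ⟨a, hRs (Or.inl rfl)⟩, Q, _, h', k, hh', hk, ?_, ?_⟩
  · ext x
    have := DFunLike.congr_fun hhk (g.codRestrict R hgR x)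
    rw [← hrg]
    exact this
  · exact DFunLike.congr_fun hhk ⟨a, hRs (Or.inl rfl)⟩

/-- Partial isomorphisms between strong substructures can be extended to any element of a
model-homogeneous `C` when the other side is saturated. -/
theorem exists_partialEquiv_extension {μ κ : Cardinal.{u}} (hμ : K.LS ≤ μ) (hμκ : μ < κ)
    {M C : Type u} [L.Structure M] [L.Structure C] (hM : K.ElementSaturated κ M)
    (hC : K.ModelHomogeneous (Order.succ μ) C) (p : M ≃ₚ[L] C) (hdom : K.Strong p.dom)
    (hcod : K.Strong p.cod) (hpμ : #p.dom ≤ μ) (a : C) :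
    ∃ q : M ≃ₚ[L] C, p ≤ q ∧ K.Strong q.dom ∧ K.Strong q.cod ∧ #q.dom ≤ μ ∧ a ∈ q.cod := by
  have hμω : ℵ₀ ≤ μ := K.aleph0_le_LS.trans hμ
  have h1μ : 1 ≤ μ := Cardinal.one_lt_aleph0.le.trans hμω
  have hMm : K.IsModel M := (K.isModel_of_strong hdom).2
  have hCm : K.IsModel C := (K.isModel_of_strong hcod).2
  have hinsert : ∀ {X : Type u} (x : X) (s : Set X), #s ≤ μ → #(insert x s : Set X) ≤ μ :=
    fun x s hs => Cardinal.mk_insert_le.trans (Cardinal.add_le_of_le hμω hs h1μ)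
  -- Saturation supplies one point `b` matching `a`, but the new domain must be a strong submodel.
  -- The images of the hulls `D` of `b` and `E` of `a` lie in a common `R`; homogeneity of `C` maps
  -- `R` into `C` over `E`, carrying `D` along and sending `b` to `a`.
  obtain ⟨b, Q, _, h, k, hh, hk, hhk, hba⟩ := hM p.dom C p.dom.subtype
    (p.cod.subtype.comp p.toEquiv.toEmbedding) a (K.isEmb_subtype hdom)
    ((K.isEmb_subtype hcod).comp_equiv p.toEquiv) (hpμ.trans_lt hμκ)
  have hcodμ : #p.cod ≤ μ := (Cardinal.mk_congr p.toEquiv.toEquiv).symm.le.trans hpμ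
  obtain ⟨D, hD, hDs, hDμ⟩ := K.exists_hull_le hMm (insert b p.dom) hμ (hinsert _ _ hpμ)
  obtain ⟨E, hE, hEs, hEμ⟩ := K.exists_hull_le hCm (insert a p.cod) hμ (hinsert _ _ hcodμ)
  obtain ⟨R, hR, hRs, hRμ⟩ := K.exists_hull_le hh.isModel_right (h '' D ∪ k '' E) hμ
    ((Cardinal.mk_union_le _ _).trans (Cardinal.add_le_of_le hμω
      (Cardinal.mk_image_le.trans hDμ) (Cardinal.mk_image_le.trans hEμ)))
  have hDR : ∀ x, (h.comp D.subtype) x ∈ R := fun x => hRs (Or.inl ⟨x, x.2, rfl⟩)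
  have hER : ∀ x, (k.comp E.subtype) x ∈ R := fun x => hRs (Or.inr ⟨x, x.2, rfl⟩)
  obtain ⟨r, hr, hrE⟩ := hC E R E.subtype ((k.comp E.subtype).codRestrict R hER)
    (K.isEmb_subtype hE) ((hk.comp (K.isEmb_subtype hE)).codRestrict hR hER)
    (Order.lt_succ_iff.2 hRμ)
  let q : D ↪[L] C := r.comp ((h.comp D.subtype).codRestrict R hDR)
  have hq : K.IsEmb q := hr.comp ((hh.comp (K.isEmb_subtype hD)).codRestrict hR hDR)
  have hqk : ∀ (x : D) (y : E), h x = k y → q x = y := by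
    intro x y hxy
    have h1 : (h.comp D.subtype).codRestrict R hDR x = (k.comp E.subtype).codRestrict R hER y :=
      Subtype.ext hxy
    have h2 := DFunLike.congr_fun hrE y
    exact (congrArg r h1).trans h2
  have hpD : p.dom ≤ D := fun x hx => hDs (Or.inr hx)
  refine ⟨⟨D, q.toHom.range, q.equivRange⟩, ⟨hpD, ?_⟩, hD, hq, hDμ, ?_⟩
  · ext x
    exact hqk ⟨x, hpD x.2⟩ ⟨p.toEquiv x, hEs (Or.inr (p.toEquiv x).2)⟩ (DFunLike.congr_fun hhk x)
  · exact ⟨⟨b, hDs (Or.inl rfl)⟩, hqk ⟨b, hDs (Or.inl rfl)⟩ ⟨a, hEs (Or.inl rfl)⟩ hba⟩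

/-- Saturated models are model-homogeneous. -/
theorem ElementSaturated.modelHomogeneous
    (hinf : ∀ (M : Type u) [L.Structure M], K.IsModel M → ℵ₀ ≤ #M) (hAP : K.Amalgamation)
    {κ : Cardinal.{u}} (hκ : K.LS < κ) {M : Type u} [L.Structure M]
    (h : K.ElementSaturated κ M) : K.ModelHomogeneous κ M := by
  intro N N' _ _ f g hf hg hN'
  have hM : K.IsModel M := hf.isModel_right
  set μ := max #N' K.LS with hμdef
  have hμκ : μ < κ := max_lt hN' hκ
  have hLSμ : K.LS ≤ μ := le_max_right _ _
  have hμω : ℵ₀ ≤ μ := K.aleph0_le_LS.trans hLSμ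
  have hNμ : #N ≤ μ := (Cardinal.mk_le_of_injective g.injective).trans (le_max_left _ _)
  have hMω := hinf M hM
  obtain ⟨C, _, j, hj, -, hC⟩ := exists_modelHomogeneous_extension K hinf hAP
    (κ := Order.succ μ) (θ := #M ^ μ) (Order.lt_succ_iff.2 hLSμ)
    (fun ν hν => by
      rw [← Cardinal.power_mul]
      exact Cardinal.power_le_power_left (Cardinal.aleph0_pos.trans_le hMω).ne'
        (Cardinal.mul_le_of_le hμω le_rfl (Order.lt_succ_iff.1 hν))) M hM
    (Cardinal.self_le_power _ (Cardinal.one_lt_aleph0.le.trans hμω))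
  obtain ⟨g', hg', hg'g⟩ := hC N N' (j.comp f) g (hj.comp hf) hg
    (Order.lt_succ_iff.2 (le_max_left _ _))
  let X := {p : M ≃ₚ[L] C // K.Strong p.dom ∧ K.Strong p.cod ∧ #p.dom ≤ μ}
  let p₀ : X := ⟨⟨f.toHom.range, (j.comp f).toHom.range,
    (j.comp f).equivRange.comp f.equivRange.symm⟩, hf, hj.comp hf,
    (Cardinal.mk_congr f.equivRange.toEquiv).symm.le.trans hNμ⟩
  have hp₀ : ∀ n (hn : f n ∈ p₀.1.dom), (p₀.1.toEquiv ⟨f n, hn⟩ : C) = j (f n) := by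
    intro n hn
    have : f.equivRange.symm ⟨f n, hn⟩ = n := f.equivRange.symm_apply_apply n
    exact congrArg (fun m => j (f m)) this
  -- Partial isomorphisms extending `j` on the range of `f` are enlarged until their image contains
  -- that of `g'`; the inverse then maps `N'` into `M` over `N`. Chains of length at most `#N' ≤ μ`
  -- keep the domains of size at most μ.
  obtain ⟨p, hpp, hpN⟩ := exists_forall_of_chain_bounded (X := X) (T := N')
    (fun n p => g' n ∈ p.1.cod) (fun n p q hpq hp => PartialEquiv.cod_le_cod hpq hp)
    (fun p n => by
      obtain ⟨q, hpq, h1, h2, h3, h4⟩ := exists_partialEquiv_extension hLSμ hμκ h hC p.1 p.2.1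
        p.2.2.1 p.2.2.2 (g' n)
      exact ⟨⟨q, h1, h2, h3⟩, hpq, h4⟩)
    (fun J _ _ hJ F hF => by
      let S : J →o (M ≃ₚ[L] C) := ⟨fun i => (F i).1, fun i i' hii => hF hii⟩
      have hSdom : Monotone fun i => (S i).dom := fun i i' hii =>
        PartialEquiv.dom_le_dom (S.monotone hii)
      have hScod : Monotone fun i => (S i).cod := fun i i' hii =>
        PartialEquiv.cod_le_cod (S.monotone hii)
      exact ⟨⟨DirectLimit.partialEquivLimit S, K.iSup_strong _ hSdom fun i => (F i).2.1,
        K.iSup_strong _ hScod fun i => (F i).2.2.1,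
        mk_iSup_directed_le hSdom hμω (hJ.trans (le_max_left _ _)) fun i => (F i).2.2.2⟩,
        fun i => DirectLimit.le_partialEquivLimit S i⟩) p₀
  refine ⟨p.1.dom.subtype.comp (p.1.toEquiv.symm.toEmbedding.comp
    (g'.codRestrict p.1.cod hpN)), (K.isEmb_subtype p.2.1).comp
    ((hg'.codRestrict p.2.2.1 hpN).equiv_comp _), ?_⟩
  refine DFunLike.ext _ _ fun n => ?_
  have hn : f n ∈ p₀.1.dom := ⟨n, rfl⟩
  have h1 := PartialEquiv.toEquiv_inclusion_apply (f := p₀.1) (g := p.1) hpp ⟨f n, hn⟩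
  have h2 : g'.codRestrict p.1.cod hpN (g n) =
      p.1.toEquiv (Substructure.inclusion (PartialEquiv.dom_le_dom hpp) ⟨f n, hn⟩) := by
    rw [h1]
    refine Subtype.ext ?_
    exact (DFunLike.congr_fun hg'g n).trans (hp₀ n hn).symm
  have h3 : p.1.toEquiv.symm (g'.codRestrict p.1.cod hpN (g n)) =
      Substructure.inclusion (PartialEquiv.dom_le_dom hpp) ⟨f n, hn⟩ := by
    rw [h2]
    exact p.1.toEquiv.symm_apply_apply _
  exact congrArg Subtype.val h3

end AEC

/-! ### Ehrenfeucht–Mostowski models -/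

section Pick

/-- The elements of `s` whose position in `s` belongs to `w`. -/
def Finset.pick {X : Type*} [LinearOrder X] (s : Finset X) (w : Finset ℕ) : Finset X :=
  s.filter fun x => (s.filter fun y => y < x).card ∈ w

theorem Finset.pick_subset {X : Type*} [LinearOrder X] (s : Finset X) (w : Finset ℕ) :
    s.pick w ⊆ s :=
  Finset.filter_subset _ _

/-- Increasing maps preserve positions, so a subset of `t` can be named independently of where `t`
is placed. -/
theorem Finset.pick_image {I X : Type*} [LinearOrder I] [LinearOrder X] {t v : Finset I}
    (hv : v ⊆ t) {b : I → X} (hb : StrictMonoOn b t) :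
    (t.image b).pick (v.image fun i => (t.filter fun j => j < i).card) = v.image b := by
  have hrank : ∀ i ∈ t, ((t.image b).filter fun y => y < b i).card =
      (t.filter fun j => j < i).card := by
    intro i hi
    have : (t.image b).filter (fun y => y < b i) = (t.filter fun j => j < i).image b := by
      ext y
      simp only [Finset.mem_filter, Finset.mem_image]
      constructor
      · rintro ⟨⟨j, hj, rfl⟩, hlt⟩
        exact ⟨j, ⟨hj, (hb.lt_iff_lt hj hi).1 hlt⟩, rfl⟩
      · rintro ⟨j, ⟨hj, hlt⟩, rfl⟩
        exact ⟨⟨j, hj, rfl⟩, (hb.lt_iff_lt hj hi).2 hlt⟩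
    rw [this]
    exact Finset.card_image_of_injOn (hb.injOn.mono (Finset.coe_subset.2 (Finset.filter_subset _ _)))
  have hinj : ∀ i ∈ t, ∀ j ∈ t, i < j →
      (t.filter fun k => k < i).card < (t.filter fun k => k < j).card := by
    intro i hi j _ hij
    refine Finset.card_lt_card ⟨fun k hk => ?_, fun h => ?_⟩
    · rw [Finset.mem_filter] at hk ⊢
      exact ⟨hk.1, hk.2.trans hij⟩
    · exact lt_irrefl i (Finset.mem_filter.1 (h (Finset.mem_filter.2 ⟨hi, hij⟩))).2
  ext x
  simp only [Finset.pick, Finset.mem_filter]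
  constructor
  · rintro ⟨hx, hw⟩
    obtain ⟨i, hi, rfl⟩ := Finset.mem_image.1 hx
    rw [hrank i hi] at hw
    obtain ⟨j, hj, hji⟩ := Finset.mem_image.1 hw
    have : j = i := by
      rcases lt_trichotomy j i with h | h | h
      · exact absurd hji (hinj j (hv hj) i hi h).ne
      · exact h
      · exact absurd hji (hinj i hi j (hv hj) h).ne'
    exact this ▸ Finset.mem_image_of_mem b hj
  · intro hx
    obtain ⟨i, hi, rfl⟩ := Finset.mem_image.1 hx
    refine ⟨Finset.mem_image_of_mem b (hv hi), ?_⟩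
    rw [hrank i (hv hi)]
    exact Finset.mem_image_of_mem _ hi

end Pick

namespace AEC
variable {L : FirstOrder.Language.{u, u}} {K : AEC L}

/-- A monotone system of small strong substructures of `M`, indexed by the finite subsets of `M`,
with enumerations by `Option Y`: the role of Skolem functions. -/
structure HullSystem (K : AEC L) (M : Type u) [L.Structure M] (S₀ : Set M) (Y : Type u) where
  E : Finset M → L.Substructure M
  strong : ∀ s, K.Strong (E s)
  mono : Monotone E
  subset : ∀ s, S₀ ⊆ E s
  e : Finset M → Option Y → M
  e_mem : ∀ s α, e s α ∈ E s
  surj : ∀ s, ∀ x ∈ E s, ∃ α, e s α = x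
  e_singleton : ∀ x, e {x} none = x

/-- Small strong submodels containing `S₀` are directed, so hulls can be chosen monotone. The index
`none` is set aside to name the point of a singleton. -/
theorem exists_hullSystem (hinf : ∀ (M : Type u) [L.Structure M], K.IsModel M → ℵ₀ ≤ #M)
    {M : Type u} [L.Structure M] (hM : K.IsModel M) (S₀ : Set M) (Y : Type u)
    (hY : K.LS ≤ #Y) (hS₀ : #S₀ ≤ #Y) : Nonempty (K.HullSystem M S₀ Y) := by
  classical
  have hYω : ℵ₀ ≤ #Y := K.aleph0_le_LS.trans hY
  let D := {S : L.Substructure M // K.Strong S ∧ S₀ ⊆ S ∧ #S ≤ #Y}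
  have hull : ∀ A : Set M, #A ≤ #Y → ∃ d : D, A ⊆ d.1 := by
    intro A hA
    obtain ⟨S, h1, h2, h3⟩ := K.exists_hull_le hM (S₀ ∪ A) hY
      ((Cardinal.mk_union_le _ _).trans (Cardinal.add_le_of_le hYω hS₀ hA))
    exact ⟨⟨S, h1, Set.subset_union_left.trans h2, h3⟩, Set.subset_union_right.trans h2⟩
  have hne : Nonempty D := (hull S₀ hS₀).nonempty
  have hdir : IsDirectedOrder D := ⟨fun d d' => by
    obtain ⟨c, hc⟩ := hull (d.1 ∪ d'.1 : Set M) ((Cardinal.mk_union_le _ _).trans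
      (Cardinal.add_le_of_le hYω d.2.2.2 d'.2.2.2))
    exact ⟨c, fun x hx => hc (Or.inl hx), fun x hx => hc (Or.inr hx)⟩⟩
  choose pt hpt using fun x : M => hull {x} (by
    rw [Cardinal.mk_singleton]
    exact Cardinal.one_lt_aleph0.le.trans hYω)
  obtain ⟨g, hg, hpg⟩ := exists_monotone_finset_bound pt
  have hmem : ∀ s : Finset M, ∀ x ∈ s, x ∈ (g s).1 := fun s x hx => hpg s x hx (hpt x rfl)
  have hsurj : ∀ s, ∃ e : Y → (g s).1, Function.Surjective e := by
    intro s
    obtain ⟨i⟩ := (g s).2.2.2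
    have : Nonempty (g s).1 := Cardinal.mk_ne_zero_iff.1
      (Cardinal.aleph0_pos.trans_le (hinf _ (K.isModel_of_strong (g s).2.1).1)).ne'
    exact ⟨Function.invFun i, Function.invFun_surjective i.injective⟩
  choose e he using hsurj
  have hfirst : ∀ s : Finset M, ∃ x ∈ (g s).1, s.Nonempty → x ∈ s := by
    intro s
    by_cases h : s.Nonempty
    · exact ⟨h.choose, hmem s _ h.choose_spec, fun _ => h.choose_spec⟩
    · have : Nonempty Y := Cardinal.mk_ne_zero_iff.1 (Cardinal.aleph0_pos.trans_le hYω).ne'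
      exact ⟨e s (Classical.arbitrary Y), (e s _).2, fun h' => absurd h' h⟩
  choose x₀ hx₀ hx₀s using hfirst
  exact ⟨{ E := fun s => (g s).1
           strong := fun s => (g s).2.1
           mono := fun s t hst => hg hst
           subset := fun s => (g s).2.2.1
           e := fun s α => α.elim (x₀ s) fun y => e s y
           e_mem := fun s α => by
             cases α
             · exact hx₀ s
             · exact (e s _).2
           surj := fun s x hx => by
             obtain ⟨y, hy⟩ := he s ⟨x, hx⟩
             exact ⟨some y, congrArg Subtype.val hy⟩
           e_singleton := fun x =>
             Finset.mem_singleton.1 (hx₀s {x} (Finset.singleton_nonempty x)) }⟩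

namespace HullSystem

variable {M : Type u} [L.Structure M] [LinearOrder M] {S₀ : Set M} {Y : Type u}
  (H : K.HullSystem M S₀ Y)

/-- The enumeration of `E s` recording the position of the hulls of all subsets of `s`. -/
def enum (s : Finset M) (x : Finset ℕ × Option Y) : H.E s :=
  ⟨H.e (s.pick x.1) x.2, H.mono (s.pick_subset x.1) (H.e_mem _ _)⟩

theorem enum_surjective (s : Finset M) : Function.Surjective (H.enum s) := by
  rintro ⟨x, hx⟩
  obtain ⟨α, rfl⟩ := H.surj s x hx
  have : s.pick (s.image fun i => (s.filter fun j => j < i).card) = s := by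
    have := Finset.pick_image (Finset.Subset.refl s) (b := id) strictMonoOn_id
    simpa using this
  exact ⟨⟨s.image fun i => (s.filter fun j => j < i).card, α⟩,
    Subtype.ext (congrArg (fun t => H.e t α) this)⟩

/-- The colour of a finite set: the diagram of its hull. -/
def colour (s : Finset M) : Set (L.Formula (Finset ℕ × Option Y)) := diagram L (H.enum s)

theorem mk_colour_le {μ : Cardinal.{u}} (hμ : ℵ₀ ≤ μ) (hL : L.card ≤ μ) (hY : #Y ≤ μ) :
    #(Set (L.Formula (Finset ℕ × Option Y))) ≤ 2 ^ μ := by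
  refine mk_diagram_le hμ hL ?_
  rw [Cardinal.mk_prod]
  refine Cardinal.mul_le_of_le hμ ?_ ?_
  · simpa using hμ
  · rw [Cardinal.lift_id', Cardinal.mk_option]
    exact Cardinal.add_le_of_le hμ hY (Cardinal.one_lt_aleph0.le.trans hμ)

/-- Finite sets with the same colours have isomorphic hulls. -/
theorem exists_embedding {I : Type u} [LinearOrder I] {t₀ t : Finset I} (ht : t₀ ⊆ t)
    {b₀ b : I → M} (hb₀ : StrictMonoOn b₀ t₀) (hb : StrictMonoOn b t)
    (hcol : H.colour (t₀.image b₀) = H.colour (t₀.image b)) :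
    ∃ F : H.E (t₀.image b₀) ↪[L] H.E (t.image b), K.IsEmb F ∧
      ∀ v ⊆ t₀, ∀ α hx, (F ⟨H.e (v.image b₀) α, hx⟩ : M) = H.e (v.image b) α := by
  obtain ⟨φ, hφ⟩ := exists_equiv_of_diagram_eq (H.enum_surjective _) (H.enum_surjective _) hcol
  have hle : H.E (t₀.image b) ≤ H.E (t.image b) := H.mono (Finset.image_subset_image ht)
  have hinc : K.IsEmb (Substructure.inclusion hle) :=
    (K.sub_iff.1 (K.coherence (H.strong _) (H.strong _) hle)).2
  refine ⟨(Substructure.inclusion hle).comp φ.toEmbedding, hinc.comp_equiv φ, ?_⟩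
  intro v hv α hx
  have h1 := Finset.pick_image hv hb₀
  have h2 := Finset.pick_image hv (hb.mono (Finset.coe_subset.2 ht))
  have h3 := hφ ⟨v.image fun i => (t₀.filter fun j => j < i).card, α⟩
  have h4 : H.enum (t₀.image b₀) ⟨v.image fun i => (t₀.filter fun j => j < i).card, α⟩ =
      ⟨H.e (v.image b₀) α, hx⟩ := Subtype.ext (congrArg (fun s => H.e s α) h1)
  rw [h4] at h3
  exact (congrArg Subtype.val h3).trans (congrArg (fun s => H.e s α) h2)

end HullSystem

/-- Ehrenfeucht–Mostowski models over a small submodel `N` of a large model `M`: every element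
lies in a strong submodel which also embeds strongly in `M` over `N`. -/
theorem exists_ehrenfeuchtMostowski
    (hinf : ∀ (M : Type u) [L.Structure M], K.IsModel M → ℵ₀ ≤ #M)
    {M N : Type u} [L.Structure M] [L.Structure N] (f : N ↪[L] M) (hf : K.IsEmb f)
    {μ : Cardinal.{u}} (hμ : K.LS ≤ μ) (hN : #N ≤ μ)
    (hM : beth (Order.succ ((2 : Cardinal.{u}) ^ μ)).ord ≤ #M)
    {lam : Cardinal.{u}} (hlam : μ ≤ lam) :
    ∃ (C : Type u) (_ : L.Structure C) (F : N ↪[L] C), K.IsModel C ∧ K.IsEmb F ∧ #C = lam ∧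
      ∀ x : C, ∃ (G : L.Substructure M) (hfG : ∀ n, f n ∈ G) (j : G ↪[L] C),
        K.Strong G ∧ K.IsEmb j ∧ j.comp (f.codRestrict G hfG) = F ∧ ∃ y, j y = x := by
  classical
  induction μ using Cardinal.inductionOn with | mk Y
  have hYω : ℵ₀ ≤ #Y := K.aleph0_le_LS.trans hμ
  have hlamω : ℵ₀ ≤ lam := hYω.trans hlam
  have hMm : K.IsModel M := hf.isModel_right
  obtain ⟨H⟩ := exists_hullSystem (K := K) hinf hMm (Set.range f) Y hμ
    (Cardinal.mk_range_le.trans hN)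
  obtain ⟨_, _⟩ := exists_wellFoundedLT M
  have hMne : Nonempty M := Cardinal.mk_ne_zero_iff.1
    (Cardinal.aleph0_pos.trans_le (hinf M hMm)).ne'
  obtain ⟨c, hc⟩ := exists_template H.colour hYω
    (HullSystem.mk_colour_le hYω (K.card_le_LS.trans hμ) le_rfl) hM
  let I := lam.ord.ToType
  have hI : #I = lam := Cardinal.mk_ord_toType lam
  -- Each finite `t` is placed on a template set of `M` independently of the others; only the
  -- colours agree.
  have hb : ∀ t : Finset I, ∃ b : I → M, StrictMonoOn b t ∧
      ∀ v ⊆ t, H.colour (v.image b) = c v.card := by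
    intro t
    obtain ⟨s, hs, hsc⟩ := hc t.card
    obtain ⟨b, hb, rfl⟩ := exists_strictMonoOn_image t s hs
    refine ⟨b, hb, fun v hv => ?_⟩
    rw [hsc _ (Finset.image_subset_image hv),
      Finset.card_image_of_injOn (hb.injOn.mono (Finset.coe_subset.2 hv))]
  choose b hb hbc using hb
  have hF : ∀ t₀ t : Finset I, t₀ ≤ t → ∃ F : H.E (t₀.image (b t₀)) ↪[L] H.E (t.image (b t)),
      K.IsEmb F ∧ ∀ v ⊆ t₀, ∀ α hx,
        (F ⟨H.e (v.image (b t₀)) α, hx⟩ : M) = H.e (v.image (b t)) α := fun t₀ t ht =>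
    H.exists_embedding ht (hb t₀) (hb t)
      ((hbc t₀ t₀ (Finset.Subset.refl _)).trans (hbc t t₀ ht).symm)
  choose F hFe hFv using hF
  -- Every point of a hull is some `H.e v α`, and the maps preserve these names; hence they compose.
  have hdir : DirectedSystem (fun t : Finset I => H.E (t.image (b t))) fun t₀ t h => F t₀ t h := by
    refine ⟨fun t x => ?_, fun t₂ t₁ t₀ h₁ h₂ x => ?_⟩
    · obtain ⟨x, hx⟩ := x
      obtain ⟨α, rfl⟩ := H.surj _ x hx
      exact Subtype.ext (hFv t t le_rfl t (Finset.Subset.refl t) α hx)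
    · obtain ⟨x, hx⟩ := x
      obtain ⟨α, rfl⟩ := H.surj _ x hx
      refine Subtype.ext ?_
      have h3 : F t₀ t₁ h₁ ⟨H.e (t₀.image (b t₀)) α, hx⟩ = ⟨H.e (t₀.image (b t₁)) α,
          H.mono (Finset.image_subset_image h₁) (H.e_mem _ _)⟩ :=
        Subtype.ext (hFv t₀ t₁ h₁ t₀ (Finset.Subset.refl t₀) α hx)
      rw [h3, hFv t₁ t₂ h₂ t₀ h₁, hFv t₀ t₂ _ t₀ (Finset.Subset.refl t₀)]
  obtain ⟨hC, hof⟩ := K.directLimit F hFe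
  set C := Language.DirectLimit (fun t : Finset I => H.E (t.image (b t))) F with hCdef
  let of : ∀ t : Finset I, H.E (t.image (b t)) ↪[L] C := DirectLimit.of L (Finset I) _ F
  have hof_f : ∀ t₀ t (h : t₀ ≤ t) x, of t (F t₀ t h x) = of t₀ x := fun t₀ t h x =>
    DirectLimit.of_f (f := F) (hij := h) (x := x)
  have hfE : ∀ s n, f n ∈ H.E s := fun s n => H.subset s ⟨n, rfl⟩
  let fE : ∀ t : Finset I, N ↪[L] H.E (t.image (b t)) := fun t =>
    f.codRestrict (H.E (t.image (b t))) (hfE _)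
  -- The image of `N` is already named over ∅, and names over ∅ are the same in every placement.
  have hfE_comp : ∀ t, (of t).comp (fE t) = (of ∅).comp (fE ∅) := by
    intro t
    refine DFunLike.ext _ _ fun n => ?_
    have h1 := hof_f ∅ t (Finset.empty_subset t) (fE ∅ n)
    refine Eq.trans (congrArg (of t) ?_) h1
    refine Subtype.ext ?_
    obtain ⟨α, hα⟩ := H.surj ∅ (f n) (hfE ∅ n)
    have hx : H.e ((∅ : Finset I).image (b ∅)) α ∈ H.E ((∅ : Finset I).image (b ∅)) :=
      H.e_mem _ _
    have h2 := hFv ∅ t (Finset.empty_subset t) ∅ (Finset.Subset.refl _) α hx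
    have h3 : fE ∅ n = ⟨H.e ((∅ : Finset I).image (b ∅)) α, hx⟩ := by
      refine Subtype.ext ?_
      simp only [Finset.image_empty]
      exact hα.symm
    rw [h3, h2, Finset.image_empty]
    exact hα.symm
  refine ⟨C, inferInstance, (of ∅).comp (fE ∅), hC,
    (hof ∅).comp (hf.codRestrict (H.strong _) _), ?_, ?_⟩
  · apply le_antisymm
    · have hsurj : Function.Surjective (fun p : Σ t : Finset I, (Option Y) =>
          of p.1 ⟨H.e (p.1.image (b p.1)) p.2, H.e_mem _ _⟩) := by
        intro x
        obtain ⟨t, ⟨y, hy⟩, rfl⟩ := DirectLimit.exists_of x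
        obtain ⟨α, rfl⟩ := H.surj _ y hy
        exact ⟨⟨t, α⟩, rfl⟩
      refine (Cardinal.mk_le_of_surjective hsurj).trans ?_
      rw [Cardinal.mk_sigma, Cardinal.sum_const', Cardinal.mk_option]
      exact Cardinal.mul_le_of_le hlamω (mk_finset_le_of_le hlamω hI.le)
        (Cardinal.add_le_of_le hlamω hlam (Cardinal.one_lt_aleph0.le.trans hlamω))
    -- The points named `none` over the singletons of `I` stay distinct, since `b t` is injective on
    -- `t`.
    · rw [← hI]
      refine Cardinal.mk_le_of_injective (f := fun i : I =>
        of {i} ⟨H.e (({i} : Finset I).image (b {i})) none, H.e_mem _ _⟩) ?_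
      have hval : ∀ (i : I) (t : Finset I) (hi : {i} ≤ t),
          (F {i} t hi ⟨H.e (({i} : Finset I).image (b {i})) none, H.e_mem _ _⟩ : M) = b t i := by
        intro i t hi
        rw [hFv {i} t hi {i} (Finset.Subset.refl _), Finset.image_singleton, H.e_singleton]
      intro i i' h
      have hi : ({i} : Finset I) ≤ {i, i'} := by simp
      have hi' : ({i'} : Finset I) ≤ {i, i'} := by simp
      simp only at h
      rw [← hof_f _ _ hi, ← hof_f _ _ hi'] at h
      have h' := congrArg Subtype.val ((of {i, i'}).injective h)
      rw [hval, hval] at h'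
      exact (hb {i, i'}).injOn (by simp) (by simp) h'
  · intro x
    obtain ⟨t, y, rfl⟩ := DirectLimit.exists_of x
    exact ⟨H.E (t.image (b t)), hfE _, of t, H.strong _, hof t, hfE_comp t, y, rfl⟩

/-- If all models in one cardinality are saturated, so are all large enough models. -/
theorem elementSaturated_of_beth_le
    (hinf : ∀ (M : Type u) [L.Structure M], K.IsModel M → ℵ₀ ≤ #M) (hAP : K.Amalgamation)
    {κ lam : Cardinal.{u}} (hκ : K.LS < κ) (hκlam : κ ≤ lam)
    (hsat : ∀ (C : Type u) [L.Structure C], K.IsModel C → #C = lam → K.ElementSaturated κ C)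
    {M : Type u} [L.Structure M]
    (hM : ∀ μ < κ, beth (Order.succ ((2 : Cardinal.{u}) ^ μ)).ord ≤ #M) :
    K.ElementSaturated κ M := by
  intro N P _ _ f g a hf hg hN
  have hμ : max #N K.LS < κ := max_lt hN hκ
  obtain ⟨C, _, F, hC, hF, hClam, hloc⟩ := exists_ehrenfeuchtMostowski hinf f hf
    (le_max_right _ _) (le_max_left _ _) (hM _ hμ) (hμ.le.trans hκlam)
  obtain ⟨b, Q, _, h, k, hh, hk, hhk, hba⟩ := hsat C hC hClam N P F g a hF hg hN
  -- The realization in `C` comes from a point `y` of a strong submodel `G` of `M` over `N`, so `y`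
  -- realizes the same type in `M`.
  obtain ⟨G, hfG, j, hG, hj, hjF, y, rfl⟩ := hloc b
  obtain ⟨Q', _, m, q, hm, hq, hmq⟩ := hAP G M Q G.subtype (h.comp j) (K.isEmb_subtype hG)
    (hh.comp hj)
  refine ⟨y, Q', _, m, q.comp k, hm, hq.comp hk, ?_, ?_⟩
  · refine DFunLike.ext _ _ fun n => ?_
    have h1 := DFunLike.congr_fun hmq (f.codRestrict G hfG n)
    have h2 := congrArg (fun z => q (h z)) (DFunLike.congr_fun hjF n)
    have h3 := congrArg q (DFunLike.congr_fun hhk n)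
    exact h1.trans (h2.trans h3)
  · exact (DFunLike.congr_fun hmq y).trans (congrArg q hba)

end AEC

/-! ### Consequences of homogeneity and the theorem -/

namespace AEC
variable {L : FirstOrder.Language.{u, u}} {K : AEC L}

theorem ModelHomogeneous.saturated (hAP : K.Amalgamation) {κ : Cardinal.{u}} (hκ : K.LS < κ)
    {M : Type u} [L.Structure M] (h : K.ModelHomogeneous κ M) : K.Saturated κ M := by
  intro S hS hSκ p
  induction p using Quot.inductionOn with | _ y =>
  obtain ⟨b, Q, _, m, k, hm, hk, hmk, hb⟩ := h.elementSaturated hAP hκ S y.N S.subtype y.emb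
    (y.a PUnit.unit) (K.isEmb_subtype hS) y.isEmb hSκ
  exact ⟨fun _ => b, Quot.sound ⟨Q, _, m, k, hm, hk, hmk, fun _ => hb⟩⟩

/-- A hull of `N'` and the sequence has size `< κ`, so it embeds in `M₀` over `N'`; the image of the
sequence realizes its type. -/
theorem ModelHomogeneous.nonForking (hAP : K.Amalgamation) {κ : Cardinal.{u}} (hκ : K.LS < κ)
    {C : Type u} [L.Structure C] {M₀ : L.Substructure C} (hM₀ : K.Strong M₀)
    (h : K.ModelHomogeneous κ M₀) (A : Set C) : K.NonForking κ A M₀ M₀ := by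
  have hκω : ℵ₀ ≤ κ := K.aleph0_le_LS.trans hκ.le
  refine ⟨K.coherence hM₀ hM₀ le_rfl, hM₀, fun I a hI _ N' hN' hN'κ => ?_⟩
  have hN'C : K.Strong N' := K.strong_trans hN' hM₀
  obtain ⟨R, hR, hRs, hRκ⟩ := K.exists_hull_lt (K.isModel_of_strong hM₀).2
    (N' ∪ Set.range a) hκ ((Cardinal.mk_union_le _ _).trans_lt
      (Cardinal.add_lt_of_lt hκω hN'κ (Cardinal.mk_range_le.trans_lt hI)))
  have haR : ∀ i, a i ∈ R := fun i => hRs (Or.inr ⟨i, rfl⟩)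
  have hle : N' ≤ R := fun x hx => hRs (Or.inl hx)
  obtain ⟨_, hN'R⟩ := K.sub_iff.1 (K.coherence hN'C hR hle)
  obtain ⟨hN'M, hN'M₀⟩ := K.sub_iff.1 hN'
  obtain ⟨r, hr, hrN⟩ := h N' R (Substructure.inclusion hN'M) (Substructure.inclusion hle)
    hN'M₀ hN'R hRκ
  obtain ⟨P, _, p, q, hp, hq, hpq⟩ := hAP R C C (M₀.subtype.comp r) R.subtype
    ((K.isEmb_subtype hM₀).comp hr) (K.isEmb_subtype hR)
  refine ⟨fun i => r ⟨a i, haR i⟩, fun i => (r ⟨a i, haR i⟩).2,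
    Quot.sound ⟨P, _, p, q, hp, hq, ?_, fun i => DFunLike.congr_fun hpq ⟨a i, haR i⟩⟩⟩
  refine DFunLike.ext _ _ fun n => ?_
  have h1 := congrArg (fun z : M₀ => p z) (DFunLike.congr_fun hrN n)
  exact h1.symm.trans (DFunLike.congr_fun hpq (Substructure.inclusion hle n))

/-- Model-homogeneity passes from strong submodels of size `lam ≥ κ` to the whole model. -/
theorem modelHomogeneous_of_le {κ lam : Cardinal.{u}} (hLS : K.LS ≤ lam) (hκlam : κ ≤ lam)
    (hlam : ∀ (C : Type u) [L.Structure C], K.IsModel C → #C = lam → K.ModelHomogeneous κ C)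
    {M : Type u} [L.Structure M] (hM : lam ≤ #M) : K.ModelHomogeneous κ M := by
  intro N N' _ _ f g hf hg hN'
  obtain ⟨S, hS, hSs, hSc⟩ := K.exists_hull_eq hf.isModel_right (Set.range f) hLS
    (Cardinal.mk_range_le.trans ((Cardinal.mk_le_of_injective g.injective).trans
      (hN'.le.trans hκlam))) hM
  have hfS : ∀ n, f n ∈ S := fun n => hSs ⟨n, rfl⟩
  obtain ⟨h, hh, hhg⟩ := hlam S (K.isModel_of_strong hS).1 hSc N N' (f.codRestrict S hfS) g
    (hf.codRestrict hS hfS) hg hN'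
  refine ⟨S.subtype.comp h, (K.isEmb_subtype hS).comp hh, ?_⟩
  refine DFunLike.ext _ _ fun n => ?_
  exact congrArg Subtype.val (DFunLike.congr_fun hhg n)

/-- Under categoricity in `lam = lam ^< κ`, all models of size at least the threshold are
`κ`-model-homogeneous. -/
theorem modelHomogeneous_of_categorical
    (hLS : ∀ (M : Type u) [L.Structure M], K.IsModel M → K.LS ≤ #M) (hAP : K.Amalgamation)
    {κ lam : Cardinal.{u}} (hκ : K.LS < κ) (hlam : lam = lam ^< κ) (hcat : K.Categorical lam)
    {M : Type u} [L.Structure M] (hMχ : satThreshold lam κ ≤ #M) :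
    K.ModelHomogeneous κ M := by
  have hinf : ∀ (M : Type u) [L.Structure M], K.IsModel M → ℵ₀ ≤ #M := fun M _ hM =>
    K.aleph0_le_LS.trans (hLS M hM)
  have hpow : ∀ ν < κ, lam ^ ν ≤ lam := fun ν hν =>
    (Cardinal.le_powerlt lam hν).trans hlam.symm.le
  obtain ⟨⟨M₁, _, hM₁, hM₁c⟩, huniq⟩ := hcat
  have hLSlam : K.LS ≤ lam := hM₁c ▸ hLS M₁ hM₁
  have hlamω : ℵ₀ ≤ lam := K.aleph0_le_LS.trans hLSlam
  have hκlam : κ ≤ lam := le_of_forall_lt fun ν hν => lt_of_lt_of_le (Cardinal.cantor ν)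
    ((Cardinal.power_le_power_right ((Cardinal.natCast_lt_aleph0 (n := 2)).le.trans hlamω)).trans
      (hpow ν hν))
  obtain ⟨C, _, j, hj, hCc, hC⟩ := exists_modelHomogeneous_extension K hinf hAP hκ hpow M₁ hM₁
    hM₁c.le
  -- The homogeneous extension still has size `lam`, so by categoricity it is the model of that
  -- size.
  have hCc' : #C = lam := hCc.antisymm (hM₁c ▸ Cardinal.mk_le_of_injective j.injective)
  have hlamMH : ∀ (D : Type u) [L.Structure D], K.IsModel D → #D = lam →
      K.ModelHomogeneous κ D := by
    intro D _ hD hDc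
    obtain ⟨e⟩ := huniq C D hj.isModel_right hD hCc' hDc
    exact hC.congr e
  rcases le_total lam #M with h | h
  · exact modelHomogeneous_of_le hLSlam hκlam hlamMH h
  · rcases min_le_iff.1 hMχ with h' | h'
    · exact modelHomogeneous_of_le hLSlam hκlam hlamMH h'
    · refine ElementSaturated.modelHomogeneous hinf hAP hκ
        (elementSaturated_of_beth_le hinf hAP hκ hκlam
          (fun D _ hD hDc => (hlamMH D hD hDc).elementSaturated hAP hκ) fun μ hμ => ?_)
      refine le_trans ?_ h'
      exact le_ciSup (f := fun μ : Set.Iio κ =>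
        beth (Order.succ ((2 : Cardinal.{u}) ^ (μ : Cardinal.{u}))).ord)
        Cardinal.bddAbove_of_small ⟨μ, hμ⟩

end AEC

theorem theorem5p5 {L : FirstOrder.Language.{u, u}} (K : AEC L)
    (hLS : ∀ (M : Type u) [L.Structure M], K.IsModel M → K.LS ≤ #M)
    (hAP : K.Amalgamation)
    (κ lam : Cardinal.{u}) (hκ : K.LS < κ)
    (hlam : lam = lam ^< κ) (hcat : K.Categorical lam) :
    (∀ (M : Type u) [L.Structure M], K.IsModel M → satThreshold lam κ ≤ #M → K.Saturated κ M) ∧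
      (∀ α μ : Cardinal.{u}, satThreshold lam κ ≤ μ → K.Existence κ α μ) := by
  refine ⟨fun M _ _ hMχ =>
    (AEC.modelHomogeneous_of_categorical hLS hAP hκ hlam hcat hMχ).saturated hAP hκ, ?_⟩
  intro α μ hμ C _ M₀ A hM₀ _ hM₀μ
  exact (AEC.modelHomogeneous_of_categorical hLS hAP hκ hlam hcat
    (hM₀μ ▸ hμ)).nonForking hAP hκ hM₀ A
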